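/- For $x\in\mathbb{R}$ let $\|x\|=\min_{m\in\mathbb{Z}}|x-m|$. For $\psi\colon\mathbb{N}=\{1,2,\dots\}\to[0,\infty)$ let $W(2,\psi)$ be the set of all $(x_1,x_2)\in[0,1]^2$ such that $\max(\|qx_1\|,\|qx_2\|)<\psi(q)$ for infinitely many $q\in\mathbb{N}$, and let $$\mathrm{Exact}(2,\psi)=W(2,\psi)\setminus\bigcup_{0<c<1}W(2,c\psi).$$ Theorem. Let $\psi\colon\mathbb{N}\to[0,\tfrac12)$ be such that $q\mapsto q\,\psi(q)$ is non-increasing and tends to $0$ as $q\to\infty$, and suppose that the limit $$\lambda=\lim_{q\to\infty}\frac{-\log\psi(q)}{\log q}\in[0,\infty]$$ exists (with $-\log 0=+\infty$). Then $$\dim_{\mathrm H}\mathrm{Exact}(2,\psi)=\frac{3}{\lambda+1},$$ where the right-hand side is $0$ if $\lambda=\infty$. -/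

import Mathlib

open Set Filter Topology MeasureTheory
open scoped ENNReal

/-- The distance `‖x‖` from a real number `x` to the nearest integer. -/
noncomputable def distNearestInt (x : ℝ) : ℝ := |x - round x|

/-- `distNearestInt x` is the minimum of `|x - m|` over the integers `m`. -/
theorem isLeast_distNearestInt (x : ℝ) :
    IsLeast (Set.range fun m : ℤ => |x - m|) (distNearestInt x) := by
  refine ⟨⟨round x, rfl⟩, ?_⟩
  rintro _ ⟨m, rfl⟩
  exact round_le x m

/-- The set `W(n, ψ)` of simultaneously `ψ`-well approximable points of `[0,1]^n` (for `n ≥ 1`):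
the points `x` for which `max_i ‖q x_i‖ < ψ(q)` holds for infinitely many `q`. -/
def wellApprox (n : ℕ) (ψ : ℕ → ℝ) : Set (EuclideanSpace ℝ (Fin n)) :=
  {x | (∀ i, x i ∈ Set.Icc (0 : ℝ) 1) ∧
    {q : ℕ | 1 ≤ q ∧ ∀ i, distNearestInt ((q : ℝ) * x i) < ψ q}.Infinite}

/-- The set `Exact(n, ψ) = W(n, ψ) \ ⋃_{0 < c < 1} W(n, cψ)`. -/
def exactApprox (n : ℕ) (ψ : ℕ → ℝ) : Set (EuclideanSpace ℝ (Fin n)) :=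
  wellApprox n ψ \ ⋃ c ∈ Set.Ioo (0 : ℝ) 1, wellApprox n (fun q => c * ψ q)

/-- `-log ψ(q) / log q` as an extended real number. `ENNReal.log` is the logarithm with
`log 0 = -∞`, so that the value is `+∞` where `ψ(q) = 0` (and `q ≥ 2`). -/
noncomputable def decayRate (ψ : ℕ → ℝ) (q : ℕ) : EReal :=
  -ENNReal.log (ENNReal.ofReal (ψ q)) / ((Real.log (q : ℝ) : ℝ) : EReal)

/-! Upper bound: each `q` contributes about `q²` balls of radius `ψ(q)/q` around rational points. If
`ψ(q) ≤ q^(-t)` eventually, the sums `Σ q^(2-(t+1)d)` converge for `d > 3/(t+1)`; then `t` increases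
to `λ`.

Lower bound (`λ < ∞`): let `(τ+1)s < 3` with `τ > λ`, and suppose that the exact set has `μH[s]`
measure zero. Cover it by balls with tiny total weight `Σ δ^s`. Nested boxes `I_k` are built whose
common point is in the exact set but in no ball of the cover, a contradiction.

The box `I_k` lies in an annulus of outer radius `ψ(q_k)/q_k` and relative width `η_k → 0` around a
primitive point `v_k/q_k`. So `v_k/q_k` approximates its points to within `ψ`, but not better than
`(1-η_k)ψ`. Given `I_k`, the next box is placed near a point `x` that avoids four sets of small
area, for a large parameter `N`: (a) neighbourhoods of other rational points of denominator at least
`1/(2ψ(q_k))`. Inside the ball around `v_k/q_k` they occupy a proportion `O((q_k ψ(q_k))²)`, small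
against `η_k²` because `qψ(q) → 0` (`exists_volume_nearOtherRational_le`); (b) points within
`400/N³` of a rational point of denominator at most `N²/1000`; (c) points whose Dirichlet
approximation of order `N` can have denominator at most `N²/100`. Elsewhere Dirichlet's theorem
gives a new centre `v'/q'` with `q'` of order `N²`, at distance `O(N⁻³)`; (d) points near which the
cover is too heavy at scale `N⁻³`. By averaging (`exists_ballWeight_exceptional_set`) their area is
controlled by `N^(-6+2(τ+1)s) → 0`; this is where the 3 comes from.

Thus each box meets covering balls of total weight at most `1/1000` of its radius to the power `s`.
A ball containing the limit point would contribute a fixed `δ^s` to weights that tend to 0. -/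

/-! ### Passage to the sup metric -/

/-- The counterpart of `wellApprox 2 ψ` in `Fin 2 → ℝ` with the sup metric. -/
def wellApproxPi (ψ : ℕ → ℝ) : Set (Fin 2 → ℝ) :=
  {x | (∀ i, x i ∈ Set.Icc (0 : ℝ) 1) ∧
    {q : ℕ | 1 ≤ q ∧ ∀ i, distNearestInt ((q : ℝ) * x i) < ψ q}.Infinite}

/-- The counterpart of `exactApprox 2 ψ` in `Fin 2 → ℝ` with the sup metric. -/
def exactApproxPi (ψ : ℕ → ℝ) : Set (Fin 2 → ℝ) :=
  wellApproxPi ψ \ ⋃ c ∈ Set.Ioo (0 : ℝ) 1, wellApproxPi (fun q => c * ψ q)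

/-- A linear homeomorphism preserves dimension. In the sup metric the condition on `max_i` becomes
membership in a ball. -/
theorem dimH_exactApprox_eq (ψ : ℕ → ℝ) : dimH (exactApprox 2 ψ) = dimH (exactApproxPi ψ) := by
  rw [← (EuclideanSpace.equiv (Fin 2) ℝ).dimH_preimage]
  congr 1
  simp only [exactApproxPi, preimage_sdiff, preimage_iUnion]
  rfl

/-- The rational point `v / q`. -/
noncomputable def ratPt (v : Fin 2 → ℤ) (q : ℕ) : Fin 2 → ℝ := fun i => (v i : ℝ) / q

/-! ### Upper bound: the natural cover -/

theorem dimH_wellApproxPi_le {ψ : ℕ → ℝ} {t : ℝ} (ht : 0 ≤ t)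
    (h : ∀ᶠ q : ℕ in atTop, ψ q ≤ (q : ℝ) ^ (-t)) :
    dimH (wellApproxPi ψ) ≤ ENNReal.ofReal (3 / (t + 1)) := by
  by_contra! hlt
  obtain ⟨d, hd1, hd2⟩ := ENNReal.lt_iff_exists_nnreal_btwn.1 hlt
  have htop := hausdorffMeasure_of_lt_dimH hd2
  have hd : 3 / (t + 1) < (d : ℝ) := by
    have := (ENNReal.ofReal_lt_iff_lt_toReal (by positivity) ENNReal.coe_ne_top).1 hd1
    simpa using this
  rw [div_lt_iff₀ (by linarith)] at hd
  have hdpos : 0 < (d : ℝ) := by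
    by_contra! hc
    nlinarith [d.2]
  -- Majorant for the balls of denominator `q`: there are `(q+1)² ≤ 4q²` of them, each of diameter
  -- at most `2q^(-(t+1))`. It is summable because `(t+1)d > 3`.
  set f : ℕ → ℝ≥0∞ := fun q => ENNReal.ofReal (4 * 2 ^ (d : ℝ) * (q : ℝ) ^ (2 - (t + 1) * d))
    with hf
  have hfsum : ∑' q, f q ≠ ⊤ := by
    have hs : Summable fun q : ℕ => 4 * 2 ^ (d : ℝ) * (q : ℝ) ^ (2 - (t + 1) * (d : ℝ)) := by
      apply Summable.mul_left
      rw [Real.summable_nat_rpow]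
      linarith
    rw [hf, ← ENNReal.ofReal_tsum_of_nonneg (fun q => by positivity) hs]
    exact ENNReal.ofReal_ne_top
  have hlim := ENNReal.tendsto_sum_nat_add f hfsum
  have key : μH[(d : ℝ)] (wellApproxPi ψ) ≤
      liminf (fun n : ℕ => ∑' k : (Σ j : ℕ, (Fin 2 → Fin (j + n + 1))),
        Metric.ediam (Metric.closedBall (fun i => ((k.2 i : ℕ) : ℝ) / ((k.1 + n : ℕ) : ℝ))
          (((k.1 + n : ℕ) : ℝ) ^ (-(t + 1)))) ^ (d : ℝ)) atTop := by
    refine Measure.hausdorffMeasure_le_liminf_tsum (d : ℝ) (wellApproxPi ψ)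
      (fun n : ℕ => ENNReal.ofReal (2 * (n : ℝ) ^ (-(t + 1)))) ?_ _ ?_ ?_
    · have h1 : Tendsto (fun n : ℕ => 2 * (n : ℝ) ^ (-(t + 1))) atTop (nhds (2 * 0)) :=
        ((tendsto_rpow_neg_atTop (by linarith)).comp tendsto_natCast_atTop_atTop).const_mul 2
      simpa using ENNReal.tendsto_ofReal h1
    · filter_upwards [eventually_ge_atTop 1] with n hn k
      refine (Metric.ediam_le_of_forall_dist_le (C := 2 * (n : ℝ) ^ (-(t + 1))) ?_)
      intro x hx y hy
      have h1 := dist_triangle_right x y (fun i => ((k.2 i : ℕ) : ℝ) / ((k.1 + n : ℕ) : ℝ))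
      have h2 : (((k.1 + n : ℕ) : ℝ) ^ (-(t + 1))) ≤ (n : ℝ) ^ (-(t + 1)) := by
        apply Real.rpow_le_rpow_of_nonpos
        · exact_mod_cast hn
        · push_cast; linarith [(Nat.cast_nonneg k.1 : (0 : ℝ) ≤ k.1)]
        · linarith
      linarith [Metric.mem_closedBall.1 hx, Metric.mem_closedBall.1 hy]
    · obtain ⟨N₀, hh⟩ := eventually_atTop.1 h
      filter_upwards [eventually_ge_atTop (max 1 N₀)] with n hn x hx
      obtain ⟨hx01, hinf⟩ := hx
      obtain ⟨q, ⟨hq1, hq⟩, hnq⟩ := hinf.exists_gt n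
      have hqpos : (0 : ℝ) < q := by exact_mod_cast hq1
      have hψ := hh q (by omega)
      obtain ⟨j, rfl⟩ : ∃ j, q = j + n := ⟨q - n, by omega⟩
      set q := j + n
      have hr0 : ∀ i, 0 ≤ round ((q : ℝ) * x i) := fun i => by
        have : 0 ≤ (q : ℝ) * x i := mul_nonneg hqpos.le (hx01 i).1
        rw [round_eq]
        exact Int.floor_nonneg.2 (by linarith)
      have hr1 : ∀ i, round ((q : ℝ) * x i) < (q : ℤ) + 1 := fun i => by
        have : (q : ℝ) * x i ≤ q := mul_le_of_le_one_right hqpos.le (hx01 i).2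
        rw [round_eq, Int.floor_lt]
        push_cast; linarith
      refine mem_iUnion.2 ⟨⟨j, fun i => ⟨(round ((q : ℝ) * x i)).toNat, ?_⟩⟩, ?_⟩
      · have := hr0 i; have := hr1 i; omega
      · rw [Metric.mem_closedBall, dist_pi_le_iff (by positivity)]
        intro i
        have e1 : (((round ((q : ℝ) * x i)).toNat : ℕ) : ℝ) = (round ((q : ℝ) * x i) : ℝ) := by
          exact_mod_cast Int.toNat_of_nonneg (hr0 i)
        have h3 := (hq i).trans_le hψ
        unfold distNearestInt at h3
        simp only [e1]
        rw [Real.dist_eq]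
        have e2 : x i - (round ((q : ℝ) * x i) : ℝ) / q
            = ((q : ℝ) * x i - round ((q : ℝ) * x i)) / q := by
          field_simp
        change |x i - (round ((q : ℝ) * x i) : ℝ) / q| ≤ _
        rw [e2, abs_div, abs_of_pos hqpos, div_le_iff₀ hqpos]
        refine h3.le.trans (le_of_eq ?_)
        rw [← Real.rpow_add_one hqpos.ne']
        congr 1; ring
  have h0 : μH[(d : ℝ)] (wellApproxPi ψ) ≤ 0 := by
    refine key.trans ?_
    rw [← hlim.liminf_eq]
    refine liminf_le_liminf ?_
    filter_upwards [eventually_ge_atTop 1] with n hn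
    rw [ENNReal.tsum_sigma']
    refine ENNReal.tsum_le_tsum fun j => ?_
    have hqpos : (0 : ℝ) < ((j + n : ℕ) : ℝ) := by exact_mod_cast (by omega)
    have hq1 : (1 : ℝ) ≤ ((j + n : ℕ) : ℝ) := by exact_mod_cast (by omega)
    have hb : ∀ c : Fin 2 → ℝ, Metric.ediam (Metric.closedBall c
        (((j + n : ℕ) : ℝ) ^ (-(t + 1)))) ^ (d : ℝ)
        ≤ ENNReal.ofReal ((2 * ((j + n : ℕ) : ℝ) ^ (-(t + 1))) ^ (d : ℝ)) := fun c => by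
      rw [← ENNReal.ofReal_rpow_of_pos (by positivity)]
      refine ENNReal.rpow_le_rpow ?_ hdpos.le
      refine Metric.ediam_le_of_forall_dist_le ?_
      intro x hx y hy
      linarith [dist_triangle_right x y c, Metric.mem_closedBall.1 hx, Metric.mem_closedBall.1 hy]
    refine (ENNReal.tsum_le_tsum fun v => hb _).trans ?_
    rw [tsum_fintype, Finset.sum_const, nsmul_eq_mul, Finset.card_univ]
    simp only [Fintype.card_pi, Fintype.card_fin, Finset.prod_const, Finset.card_univ]
    rw [← ENNReal.ofReal_natCast, ← ENNReal.ofReal_mul (by positivity)]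
    apply ENNReal.ofReal_le_ofReal
    rw [Real.mul_rpow (by norm_num) (by positivity), ← Real.rpow_mul hqpos.le,
      show (2 : ℝ) - (t + 1) * d = 2 + -(t + 1) * d by ring, Real.rpow_add hqpos]
    have e : (((j + n + 1) ^ 2 : ℕ) : ℝ) ≤ 4 * ((j + n : ℕ) : ℝ) ^ (2 : ℝ) := by
      rw [Real.rpow_two]; push_cast at hq1 ⊢; nlinarith
    calc _ ≤ 4 * ((j + n : ℕ) : ℝ) ^ (2 : ℝ) *
          (2 ^ (d : ℝ) * ((j + n : ℕ) : ℝ) ^ (-(t + 1) * (d : ℝ))) := by gcongr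
      _ = _ := by ring
  rw [htop] at h0
  exact absurd h0 (by simp)

/-! ### Power bounds from the decay rate -/

theorem eventually_le_rpow_of_lt_decayRate {ψ : ℕ → ℝ} {t : ℝ}
    (h : ∀ᶠ q in atTop, (t : EReal) < decayRate ψ q) :
    ∀ᶠ q : ℕ in atTop, ψ q ≤ (q : ℝ) ^ (-t) := by
  filter_upwards [h, eventually_ge_atTop 2] with q hq hq2
  have hqpos : (0 : ℝ) < q := by exact_mod_cast (by omega)
  have hlog : 0 < Real.log q := Real.log_pos (by exact_mod_cast hq2)
  by_cases hψ : 0 < ψ q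
  · rw [decayRate, ENNReal.log_ofReal_of_pos hψ] at hq
    rw [← EReal.coe_neg, ← EReal.coe_div, EReal.coe_lt_coe_iff] at hq
    rw [lt_div_iff₀ hlog] at hq
    rw [← Real.log_le_log_iff hψ (by positivity), Real.log_rpow hqpos]
    linarith
  · exact (not_lt.1 hψ).trans (by positivity)

theorem eventually_rpow_le_of_decayRate_lt {ψ : ℕ → ℝ} {t : ℝ}
    (h : ∀ᶠ q in atTop, decayRate ψ q < (t : EReal)) :
    ∀ᶠ q : ℕ in atTop, (q : ℝ) ^ (-t) ≤ ψ q := by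
  filter_upwards [h, eventually_ge_atTop 2] with q hq hq2
  have hqpos : (0 : ℝ) < q := by exact_mod_cast (by omega)
  have hlog : 0 < Real.log q := Real.log_pos (by exact_mod_cast hq2)
  by_cases hψ : 0 < ψ q
  · rw [decayRate, ENNReal.log_ofReal_of_pos hψ] at hq
    rw [← EReal.coe_neg, ← EReal.coe_div, EReal.coe_lt_coe_iff] at hq
    rw [div_lt_iff₀ hlog] at hq
    rw [← Real.log_le_log_iff (by positivity) hψ, Real.log_rpow hqpos]
    linarith
  -- Here the rate is `⊤`, so it cannot lie below `t`.
  · rw [decayRate, ENNReal.ofReal_of_nonpos (not_lt.1 hψ), ENNReal.log_zero, EReal.neg_bot,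
      EReal.top_div_of_pos_ne_top (by exact_mod_cast hlog) (EReal.coe_ne_top _)] at hq
    exact absurd hq (by simp)

/-! ### Rational points: reduced form, separation, Dirichlet's theorem -/

/-- The denominator `q` of `v / q` is the least possible one. -/
def IsPrimitive (v : Fin 2 → ℤ) (q : ℕ) : Prop :=
  ∀ m : ℤ, (∀ i, (q : ℤ) ∣ m * v i) → (q : ℤ) ∣ m

theorem ratPt_eq_iff {v w : Fin 2 → ℤ} {q n : ℕ} (hq : 1 ≤ q) (hn : 1 ≤ n) :
    ratPt w n = ratPt v q ↔ ∀ i, (q : ℤ) * w i = n * v i := by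
  have hq0 : (q : ℝ) ≠ 0 := by exact_mod_cast (by omega)
  have hn0 : (n : ℝ) ≠ 0 := by exact_mod_cast (by omega)
  rw [funext_iff]
  refine forall_congr' fun i => ?_
  simp only [ratPt]
  rw [div_eq_div_iff hn0 hq0]
  constructor
  · intro h
    have : (q : ℝ) * w i = n * v i := by linarith
    exact_mod_cast this
  · intro h
    have : (q : ℝ) * w i = n * v i := by exact_mod_cast h
    linarith

/-- The least positive `n` that makes `n · v/q` integral works: if `m · w/n` is integral and `n`
does not divide `m`, the remainder `m % n` is a smaller denominator. -/
theorem exists_isPrimitive (v : Fin 2 → ℤ) {q : ℕ} (hq : 1 ≤ q) :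
    ∃ w : Fin 2 → ℤ, ∃ n : ℕ, 1 ≤ n ∧ n ≤ q ∧ IsPrimitive w n ∧ ratPt w n = ratPt v q := by
  classical
  let P : ℕ → Prop := fun n => 1 ≤ n ∧ ∃ w : Fin 2 → ℤ, ∀ i, (q : ℤ) * w i = n * v i
  have hP : ∃ n, P n := ⟨q, hq, v, fun i => rfl⟩
  obtain ⟨hn1, w, hw⟩ := Nat.find_spec hP
  set n := Nat.find hP with hn
  have hn0 : (0 : ℤ) < n := by exact_mod_cast hn1
  refine ⟨w, n, hn1, Nat.find_min' hP ⟨hq, v, fun i => rfl⟩, ?_, (ratPt_eq_iff hq hn1).2 hw⟩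
  intro m hm
  by_contra hdvd
  have h1 : 0 ≤ m % n := Int.emod_nonneg _ hn0.ne'
  have h2 : m % n < n := Int.emod_lt_of_pos _ hn0
  have h3 : m % n ≠ 0 := fun h => hdvd (Int.dvd_of_emod_eq_zero h)
  refine Nat.find_min hP (m := (m % n).toNat) (by omega) ⟨by omega, ?_⟩
  choose c hc using hm
  refine ⟨fun i => c i - (m / n) * w i, fun i => ?_⟩
  rw [Int.toNat_of_nonneg h1, Int.emod_def]
  have e1 := hc i
  have e2 := hw i
  apply mul_left_cancel₀ hn0.ne'
  linear_combination (m - 2 * ↑n * (m / ↑n)) * e2 - (q : ℤ) * e1 + ↑n * (m / ↑n) * e2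

theorem IsPrimitive.le_of_ratPt_eq {v w : Fin 2 → ℤ} {q n : ℕ} (h : IsPrimitive v q) (hq : 1 ≤ q)
    (hn : 1 ≤ n) (heq : ratPt w n = ratPt v q) : q ≤ n := by
  have h1 := (ratPt_eq_iff hq hn).1 heq
  exact Nat.le_of_dvd hn (by exact_mod_cast h n fun i => ⟨w i, (h1 i).symm⟩)

theorem one_div_le_dist_ratPt {v w : Fin 2 → ℤ} {q n : ℕ} (hq : 1 ≤ q)
    (hn : 1 ≤ n) (hne : ratPt w n ≠ ratPt v q) :
    1 / ((q : ℝ) * n) ≤ dist (ratPt w n) (ratPt v q) := by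
  rw [Ne, ratPt_eq_iff hq hn] at hne
  push Not at hne
  obtain ⟨i, hi⟩ := hne
  have hq0 : (0 : ℝ) < q := by exact_mod_cast hq
  have hn0 : (0 : ℝ) < n := by exact_mod_cast hn
  refine le_trans ?_ (dist_le_pi_dist _ _ i)
  rw [Real.dist_eq]
  simp only [ratPt]
  have e : (w i : ℝ) / n - (v i : ℝ) / q = ((q * w i - n * v i : ℤ) : ℝ) / (q * n) := by
    push_cast; field_simp
  rw [e, abs_div, abs_of_pos (by positivity : (0 : ℝ) < q * n)]
  gcongr
  exact_mod_cast Int.one_le_abs (sub_ne_zero.2 hi)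

/-- Dirichlet's pigeonhole: two of the `N² + 1` multiples `0, x, …, N²x` fall modulo 1 into the same
of `N²` cells. Reducing the fraction lowers the denominator and so only weakens the bound `1/(qN)`.
-/
theorem exists_ratPt_dist_le (x : Fin 2 → ℝ) {N : ℕ} (hN : 1 ≤ N) :
    ∃ v : Fin 2 → ℤ, ∃ q : ℕ, 1 ≤ q ∧ q ≤ N ^ 2 ∧ IsPrimitive v q ∧
      dist x (ratPt v q) ≤ 1 / ((q : ℝ) * N) := by
  have hN0 : (0 : ℝ) < N := by exact_mod_cast hN
  let f : Fin (N ^ 2 + 1) → (Fin 2 → Fin N) := fun j i =>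
    ⟨⌊N * Int.fract ((j : ℕ) * x i)⌋.toNat, by
      have h0 := Int.fract_nonneg (((j : ℕ) : ℝ) * x i)
      have h1 := Int.fract_lt_one (((j : ℕ) : ℝ) * x i)
      have h2 : ⌊N * Int.fract (((j : ℕ) : ℝ) * x i)⌋ < (N : ℤ) := by
        rw [Int.floor_lt]; push_cast; nlinarith
      omega⟩
  obtain ⟨j, k, hjk, hf⟩ : ∃ j k : Fin (N ^ 2 + 1), j < k ∧ f j = f k := by
    obtain ⟨j, k, hne, h⟩ := Fintype.exists_ne_map_eq_of_card_lt f (by simp)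
    rcases lt_or_gt_of_ne hne with h' | h'
    · exact ⟨j, k, h', h⟩
    · exact ⟨k, j, h', h.symm⟩
  have hjk' : (j : ℕ) < k := hjk
  set q : ℕ := (k : ℕ) - j
  have hq : 1 ≤ q := by omega
  have hqle : q ≤ N ^ 2 := by have := k.2; omega
  have hq0 : (0 : ℝ) < q := by exact_mod_cast hq
  have hqc : (q : ℝ) = (k : ℕ) - (j : ℕ) := by
    rw [Nat.cast_sub hjk'.le]
  obtain ⟨w, n, hn1, hnq, hprim, heq⟩ :=
    exists_isPrimitive (fun i => ⌊((k : ℕ) : ℝ) * x i⌋ - ⌊((j : ℕ) : ℝ) * x i⌋) hq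
  refine ⟨w, n, hn1, hnq.trans hqle, hprim, ?_⟩
  rw [heq]
  have hn0 : (0 : ℝ) < n := by exact_mod_cast hn1
  calc _ ≤ 1 / ((q : ℝ) * N) := by
        rw [dist_pi_le_iff (by positivity)]
        intro i
        have h1 := congrArg Fin.val (congrFun hf i)
        simp only [f] at h1
        have a0 := Int.fract_nonneg (((j : ℕ) : ℝ) * x i)
        have b0 := Int.fract_nonneg (((k : ℕ) : ℝ) * x i)
        have h2 : ⌊N * Int.fract (((j : ℕ) : ℝ) * x i)⌋ = ⌊N * Int.fract (((k : ℕ) : ℝ) * x i)⌋ := by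
          have : 0 ≤ ⌊N * Int.fract (((j : ℕ) : ℝ) * x i)⌋ := Int.floor_nonneg.2 (by positivity)
          have : 0 ≤ ⌊N * Int.fract (((k : ℕ) : ℝ) * x i)⌋ := Int.floor_nonneg.2 (by positivity)
          omega
        have h3 := Int.abs_sub_lt_one_of_floor_eq_floor h2
        rw [← mul_sub, abs_mul, abs_of_pos hN0] at h3
        have e : x i - ratPt (fun i => ⌊((k : ℕ) : ℝ) * x i⌋ - ⌊((j : ℕ) : ℝ) * x i⌋) q i
            = -(Int.fract (((j : ℕ) : ℝ) * x i) - Int.fract (((k : ℕ) : ℝ) * x i)) / q := by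
          simp only [ratPt, Int.fract]
          push_cast
          rw [eq_div_iff hq0.ne', sub_mul, div_mul_cancel₀ _ hq0.ne', hqc]
          ring
        rw [Real.dist_eq, e, abs_div, abs_neg, abs_of_pos hq0, div_le_div_iff₀ hq0 (by positivity)]
        nlinarith
    _ ≤ _ := by gcongr

/-! ### Areas of neighbourhoods of rational points -/

theorem volume_inter_iUnion_closedBall_ratPt_le (y : Fin 2 → ℝ) {a R : ℝ} (ha : 0 ≤ a)
    (hR : 0 ≤ R) {q : ℕ} (hq : 1 ≤ q) :
    volume (Metric.closedBall y a ∩ ⋃ v : Fin 2 → ℤ, Metric.closedBall (ratPt v q) R) ≤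
      ENNReal.ofReal ((2 * q * (a + R) + 1) ^ 2 * (2 * R) ^ 2) := by
  have hq0 : (0 : ℝ) < q := by exact_mod_cast hq
  let T : Finset (Fin 2 → ℤ) :=
    Fintype.piFinset fun i => Finset.Icc ⌈q * (y i - (a + R))⌉ ⌊q * (y i + (a + R))⌋
  have hsub : Metric.closedBall y a ∩ ⋃ v : Fin 2 → ℤ, Metric.closedBall (ratPt v q) R ⊆
      ⋃ v ∈ T, Metric.closedBall (ratPt v q) R := by
    rintro x ⟨hx, hx'⟩
    obtain ⟨v, hv⟩ := mem_iUnion.1 hx'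
    refine mem_biUnion (Fintype.mem_piFinset.2 fun i => ?_) hv
    have h1 := (dist_le_pi_dist x y i).trans hx
    have h2 := (dist_le_pi_dist x (ratPt v q) i).trans hv
    rw [Real.dist_eq, abs_le] at h1 h2
    have e : (v i : ℝ) = q * ratPt v q i := by simp only [ratPt]; field_simp
    rw [Finset.mem_Icc, Int.ceil_le, Int.le_floor, e]
    constructor <;> apply mul_le_mul_of_nonneg_left _ hq0.le <;> linarith
  refine (measure_mono hsub).trans ((measure_biUnion_finset_le _ _).trans ?_)
  simp only [Real.volume_pi_closedBall _ hR, Fintype.card_fin, Finset.sum_const, nsmul_eq_mul]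
  rw [← ENNReal.ofReal_natCast, ← ENNReal.ofReal_mul (by positivity)]
  apply ENNReal.ofReal_le_ofReal
  gcongr
  rw [Fintype.card_piFinset, Nat.cast_prod]
  refine (Finset.prod_le_prod (g := fun _ => 2 * q * (a + R) + 1) (fun _ _ => by positivity)
    fun i _ => ?_).trans (by simp)
  rw [Int.card_Icc]
  have h1 := Int.le_ceil (q * (y i - (a + R)))
  have h2 := Int.floor_le (q * (y i + (a + R)))
  have h3 : (((⌊q * (y i + (a + R))⌋ + 1 - ⌈q * (y i - (a + R))⌉).toNat : ℤ) : ℝ)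
      ≤ max (2 * q * (a + R) + 1) 0 := by
    rw [Int.toNat_eq_max]
    push_cast
    apply max_le_max _ le_rfl
    linarith
  rw [max_eq_left (by positivity)] at h3
  exact_mod_cast h3

/-- A count by area fails near `v/q`, so `p/n` is encoded by the nonzero integer vector `u = qp -
nv` and `j = n / q`. The distance condition gives `‖u‖ ≤ 2δn`, while `n ≥ (j+1)q/2`. Splitting `n⁻⁴
= n^(-5/2) n^(-3/2)` yields a convergent sum over `u ∈ ℤ²` (as `5/2 > 2`) times one over `j` (as
`3/2 > 1`). -/
theorem exists_local_tsum_le : ∃ C : ℝ, 0 < C ∧ ∀ (v : Fin 2 → ℤ) (q : ℕ) (δ : ℝ), 1 ≤ q →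
    IsPrimitive v q → 0 < δ → 4 * q * δ ≤ 1 →
    ∑' k : {k : (Fin 2 → ℤ) × ℕ // 1 ≤ k.2 ∧ ratPt k.1 k.2 ≠ ratPt v q ∧
      dist (ratPt k.1 k.2) (ratPt v q) ≤ 2 * (δ / q)}, ENNReal.ofReal (1 / (k.1.2 : ℝ) ^ 4) ≤
    ENNReal.ofReal (C * (δ / q) ^ 2) := by
  set g : (Fin 2 → ℤ) × ℕ → ℝ≥0∞ := fun k =>
    ENNReal.ofReal (‖k.1‖ ^ (-(5 / 2) : ℝ)) * ENNReal.ofReal (((k.2 : ℝ) + 1) ^ (-(3 / 2) : ℝ))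
    with hg
  have hg_ne : ∑' k, g k ≠ ⊤ := by
    have h1 : ∑' u : Fin 2 → ℤ, ENNReal.ofReal (‖u‖ ^ (-(5 / 2) : ℝ)) ≠ ⊤ := by
      rw [← ENNReal.ofReal_tsum_of_nonneg (fun _ => by positivity)
        (EisensteinSeries.summable_one_div_norm_rpow (by norm_num))]
      exact ENNReal.ofReal_ne_top
    have h2 : ∑' j : ℕ, ENNReal.ofReal (((j : ℝ) + 1) ^ (-(3 / 2) : ℝ)) ≠ ⊤ := by
      have hs : Summable fun j : ℕ => ((j : ℝ) + 1) ^ (-(3 / 2) : ℝ) := by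
        have := (summable_nat_add_iff 1).2
          (Real.summable_nat_rpow.2 (by norm_num : (-(3 / 2) : ℝ) < -1))
        simpa using this
      rw [← ENNReal.ofReal_tsum_of_nonneg (fun _ => by positivity) hs]
      exact ENNReal.ofReal_ne_top
    rw [ENNReal.tsum_prod']
    simp only [hg, ENNReal.tsum_mul_left, ENNReal.tsum_mul_right]
    exact ENNReal.mul_ne_top h1 h2
  refine ⟨16 * ((∑' k, g k).toReal + 1), by positivity, fun v q δ hq hprim hδ hqδ => ?_⟩
  set S := {k : (Fin 2 → ℤ) × ℕ // 1 ≤ k.2 ∧ ratPt k.1 k.2 ≠ ratPt v q ∧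
      dist (ratPt k.1 k.2) (ratPt v q) ≤ 2 * (δ / q)}
  have hq0 : (0 : ℝ) < q := by exact_mod_cast hq
  have hqZ : (0 : ℤ) < q := by exact_mod_cast hq
  let φ : S → (Fin 2 → ℤ) × ℕ := fun k =>
    (fun i => (q : ℤ) * k.1.1 i - k.1.2 * v i, k.1.2 / q)
  have hφ : Function.Injective φ := by
    rintro ⟨⟨p, n⟩, hk⟩ ⟨⟨p', n'⟩, hk'⟩ h
    simp only [φ, Prod.mk.injEq, funext_iff] at h
    obtain ⟨h1, h2⟩ := h
    -- Primitivity of `v/q` makes `u` determine `n` modulo `q`; the quotient `j` then determines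
    -- `n`, and `p` follows.
    have h3 : (q : ℤ) ∣ (n : ℤ) - n' := hprim _ fun i => ⟨p i - p' i, by linear_combination -h1 i⟩
    have h4 : n = n' := by
      have e : (n : ℤ) % q = n' % q :=
        Int.emod_eq_emod_iff_emod_sub_eq_zero.2 (Int.emod_eq_zero_of_dvd h3)
      have e' : n % q = n' % q := by exact_mod_cast e
      rw [← Nat.div_add_mod n q, ← Nat.div_add_mod n' q, h2, e']
    subst h4
    have h5 : p = p' := funext fun i => by
      have := h1 i
      exact mul_left_cancel₀ hqZ.ne' (by linarith)
    subst h5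
    rfl
  have hterm : ∀ k : S, ENNReal.ofReal (1 / (k.1.2 : ℝ) ^ 4) ≤
      ENNReal.ofReal (16 * (δ / q) ^ 2) * g (φ k) := by
    rintro ⟨⟨p, n⟩, hn, hne, hd⟩
    simp only at hn hne hd
    have hn0 : (0 : ℝ) < n := by exact_mod_cast hn
    simp only [hg, φ]
    set u : Fin 2 → ℤ := fun i => (q : ℤ) * p i - n * v i with hu
    have hu0 : u ≠ 0 := fun h => hne ((ratPt_eq_iff hq hn).2 fun i => by
      have := congrFun h i
      simp only [hu, Pi.zero_apply] at this
      linarith)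
    have hu1 : 1 ≤ ‖u‖ := by
      obtain ⟨i, hi⟩ := Function.ne_iff.1 hu0
      refine le_trans ?_ (norm_le_pi_norm u i)
      rw [Int.norm_eq_abs]
      exact_mod_cast Int.one_le_abs hi
    have hu2 : ‖u‖ ≤ 2 * δ * n := by
      rw [pi_norm_le_iff_of_nonneg (by positivity)]
      intro i
      have h1 := (dist_le_pi_dist _ _ i).trans hd
      rw [Real.dist_eq] at h1
      simp only [ratPt] at h1
      have e : (p i : ℝ) / n - (v i : ℝ) / q = (u i : ℝ) / (q * n) := by
        simp only [hu]; push_cast; field_simp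
      rw [e, abs_div, abs_of_pos (by positivity : (0 : ℝ) < q * n), div_le_iff₀ (by positivity)] at h1
      rw [Int.norm_eq_abs]
      refine h1.trans (le_of_eq ?_)
      field_simp
    set j := n / q
    have hj : ((j : ℝ) + 1) * (q / 2) ≤ n := by
      have h1 : (j : ℝ) * q ≤ n := by exact_mod_cast Nat.div_mul_le_self n q
      -- From `1 ≤ ‖u‖ ≤ 2δn` and `4qδ ≤ 1`.
      have h2 : 2 * (q : ℝ) ≤ n := by
        by_contra! hc
        nlinarith
      linarith
    rw [← ENNReal.ofReal_mul (by positivity), ← ENNReal.ofReal_mul (by positivity)]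
    apply ENNReal.ofReal_le_ofReal
    have hm : ‖u‖ / (2 * δ) ≤ n := by rw [div_le_iff₀ (by positivity)]; linarith
    have hupos : 0 < ‖u‖ := by linarith
    calc 1 / (n : ℝ) ^ 4 = (n : ℝ) ^ (-(5 / 2) : ℝ) * (n : ℝ) ^ (-(3 / 2) : ℝ) := by
          rw [← Real.rpow_add hn0, one_div, ← Real.rpow_natCast, ← Real.rpow_neg hn0.le]
          norm_num
      _ ≤ (‖u‖ / (2 * δ)) ^ (-(5 / 2) : ℝ) * (((j : ℝ) + 1) * (q / 2)) ^ (-(3 / 2) : ℝ) := by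
          gcongr ?_ * ?_
          · exact Real.rpow_le_rpow_of_nonpos (by positivity) hm (by norm_num)
          · exact Real.rpow_le_rpow_of_nonpos (by positivity) hj (by norm_num)
      _ = ((2 * δ) ^ (5 / 2 : ℝ) * ((q : ℝ) / 2) ^ (-(3 / 2) : ℝ)) *
          (‖u‖ ^ (-(5 / 2) : ℝ) * ((j : ℝ) + 1) ^ (-(3 / 2) : ℝ)) := by
          rw [Real.div_rpow (norm_nonneg u) (by positivity : 0 ≤ 2 * δ),
            Real.mul_rpow (by positivity : (0 : ℝ) ≤ j + 1) (by positivity : 0 ≤ (q : ℝ) / 2),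
            Real.rpow_neg (by positivity : 0 ≤ 2 * δ), div_inv_eq_mul]
          ring
      _ ≤ _ := by
          refine mul_le_mul_of_nonneg_right ?_ (by positivity)
          have e1 : (2 * δ) ^ (5 / 2 : ℝ) = (2 * δ) ^ 2 * (2 * δ) ^ (1 / 2 : ℝ) := by
            rw [← Real.rpow_two, ← Real.rpow_add (by positivity)]; norm_num
          have e2 : ((q : ℝ) / 2) ^ (-(3 / 2) : ℝ) = ((q : ℝ) / 2)⁻¹ ^ 2 * ((q : ℝ) / 2) ^ (1 / 2 : ℝ) := by
            rw [← Real.rpow_two, Real.inv_rpow (by positivity), ← Real.rpow_neg (by positivity),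
              ← Real.rpow_add (by positivity)]; norm_num
          -- The surplus factor is `(δq)^(1/2)`, at most 1.
          have e3 : (2 * δ) ^ (1 / 2 : ℝ) * ((q : ℝ) / 2) ^ (1 / 2 : ℝ) ≤ 1 := by
            rw [← Real.mul_rpow (by positivity) (by positivity)]
            exact Real.rpow_le_one (by positivity) (by nlinarith) (by norm_num)
          rw [e1, e2]
          calc _ = ((2 * δ) ^ 2 * ((q : ℝ) / 2)⁻¹ ^ 2) *
                ((2 * δ) ^ (1 / 2 : ℝ) * ((q : ℝ) / 2) ^ (1 / 2 : ℝ)) := by ring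
            _ ≤ ((2 * δ) ^ 2 * ((q : ℝ) / 2)⁻¹ ^ 2) * 1 := by gcongr
            _ = _ := by field_simp; norm_num
  calc _ ≤ ∑' k : S, ENNReal.ofReal (16 * (δ / q) ^ 2) * g (φ k) := ENNReal.tsum_le_tsum hterm
    _ = ENNReal.ofReal (16 * (δ / q) ^ 2) * ∑' k : S, g (φ k) := ENNReal.tsum_mul_left
    _ ≤ ENNReal.ofReal (16 * (δ / q) ^ 2) * ∑' k, g k := by
        gcongr
        exact ENNReal.tsum_comp_le_tsum_of_injective hφ g
    _ = ENNReal.ofReal (16 * (δ / q) ^ 2 * (∑' k, g k).toReal) := by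
        rw [ENNReal.ofReal_mul (p := 16 * (δ / q) ^ 2) (by positivity), ENNReal.ofReal_toReal hg_ne]
    _ ≤ _ := by
        apply ENNReal.ofReal_le_ofReal
        nlinarith [sq_nonneg (δ / q)]

theorem volume_inter_exists_dist_ratPt_le (y : Fin 2 → ℝ) {a : ℝ} (ha : 0 ≤ a) (m : ℕ)
    {R : ℕ → ℝ} (hR : ∀ n, 0 ≤ R n) :
    volume (Metric.closedBall y a ∩
      {x | ∃ (n : ℕ) (p : Fin 2 → ℤ), 1 ≤ n ∧ n ≤ m ∧ dist x (ratPt p n) ≤ R n}) ≤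
      ENNReal.ofReal (∑ n ∈ Finset.Icc 1 m, (2 * n * (a + R n) + 1) ^ 2 * (2 * R n) ^ 2) := by
  rw [ENNReal.ofReal_sum_of_nonneg fun n _ => by positivity]
  refine le_trans (measure_mono (t := ⋃ n ∈ Finset.Icc 1 m, (Metric.closedBall y a ∩
    ⋃ v : Fin 2 → ℤ, Metric.closedBall (ratPt v n) (R n))) ?_) ?_
  · rintro x ⟨hx, n, p, hn1, hnm, hd⟩
    exact mem_biUnion (x := n) (Finset.mem_coe.2 (Finset.mem_Icc.2 ⟨hn1, hnm⟩))
      ⟨hx, mem_iUnion.2 ⟨p, hd⟩⟩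
  · refine (measure_biUnion_finset_le _ _).trans (Finset.sum_le_sum fun n hn => ?_)
    exact volume_inter_iUnion_closedBall_ratPt_le y ha (hR n) (Finset.mem_Icc.1 hn).1

/-- About `(nρ)²` balls of area of order `N⁻⁶` for each `n ≤ N²/1000`: the total is a small multiple
of `ρ²`, plus an error that vanishes as `N` grows. -/
theorem volume_inter_near_small_denominators_le (y : Fin 2 → ℝ) {ρ : ℝ} (hρ : 0 < ρ) {N : ℕ}
    (hN : 1 ≤ N) (h1 : 400 / (N : ℝ) ^ 3 ≤ ρ / 2) (h2 : 1280 / (N : ℝ) ^ 4 ≤ ρ ^ 2 / 10) :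
    volume (Metric.closedBall y (ρ / 2) ∩ {x | ∃ (n : ℕ) (p : Fin 2 → ℤ),
      1 ≤ n ∧ n ≤ N ^ 2 / 1000 ∧ dist x (ratPt p n) ≤ 400 / (N : ℝ) ^ 3}) ≤
      ENNReal.ofReal (ρ ^ 2 / 5) := by
  have hN0 : (0 : ℝ) < N := by exact_mod_cast hN
  refine (volume_inter_exists_dist_ratPt_le y (by positivity) _
    (R := fun _ => 400 / (N : ℝ) ^ 3) fun n => by positivity).trans ?_
  apply ENNReal.ofReal_le_ofReal
  have hdiv : ((N ^ 2 / 1000 : ℕ) : ℝ) ≤ (N : ℝ) ^ 2 / 1000 := by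
    have := Nat.cast_div_le (α := ℝ) (m := N ^ 2) (n := 1000)
    push_cast at this; exact this
  have hterm : ∀ n : ℕ, n ∈ Finset.Icc 1 (N ^ 2 / 1000) →
      (2 * (n : ℝ) * (ρ / 2 + 400 / (N : ℝ) ^ 3) + 1) ^ 2 * (2 * (400 / (N : ℝ) ^ 3)) ^ 2 ≤
      (8 * ((N : ℝ) ^ 2 / 1000) ^ 2 * ρ ^ 2 + 2) * (640000 / (N : ℝ) ^ 6) := by
    intro n hn
    have hn1 : (n : ℝ) ≤ (N : ℝ) ^ 2 / 1000 :=
      le_trans (by exact_mod_cast (Finset.mem_Icc.1 hn).2) hdiv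
    have e : (2 * (400 / (N : ℝ) ^ 3)) ^ 2 = 640000 / (N : ℝ) ^ 6 := by field_simp; norm_num
    rw [e]
    gcongr
    calc (2 * (n : ℝ) * (ρ / 2 + 400 / (N : ℝ) ^ 3) + 1) ^ 2
        ≤ (2 * ((N : ℝ) ^ 2 / 1000) * (ρ / 2 + ρ / 2) + 1) ^ 2 := by gcongr
      _ ≤ _ := by nlinarith [sq_nonneg (2 * ((N : ℝ) ^ 2 / 1000) * ρ - 1)]
  refine (Finset.sum_le_sum hterm).trans ?_
  rw [Finset.sum_const, Nat.card_Icc, nsmul_eq_mul, Nat.add_sub_cancel]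
  calc _ ≤ (N : ℝ) ^ 2 / 1000 *
        ((8 * ((N : ℝ) ^ 2 / 1000) ^ 2 * ρ ^ 2 + 2) * (640000 / (N : ℝ) ^ 6)) := by gcongr
    _ = 0.00512 * ρ ^ 2 + 1280 / (N : ℝ) ^ 4 := by field_simp; ring
    _ ≤ _ := by nlinarith [sq_nonneg ρ]

/-- About `(nρ)²` balls of area of order `(nN)⁻²` for each `n`, hence `ρ²/N²` per denominator.
Stopping at `N²/100` leaves a small share of the box. -/
theorem volume_inter_small_dirichlet_denominators_le (y : Fin 2 → ℝ) {ρ : ℝ} (hρ : 0 < ρ)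
    {N : ℕ} (hN : 1 ≤ N) (h2 : 144 / (N : ℝ) ^ 2 ≤ ρ ^ 2 / 10) :
    volume (Metric.closedBall y (ρ / 2) ∩ {x | ∃ (n : ℕ) (p : Fin 2 → ℤ),
      1 ≤ n ∧ n ≤ N ^ 2 / 100 ∧ dist x (ratPt p n) ≤ 1 / ((n : ℝ) * N)}) ≤
      ENNReal.ofReal (ρ ^ 2 / 5) := by
  have hN1 : (1 : ℝ) ≤ N := by exact_mod_cast hN
  have hN0 : (0 : ℝ) < N := by linarith
  refine (volume_inter_exists_dist_ratPt_le y (by positivity) _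
    (R := fun n => 1 / ((n : ℝ) * N)) fun n => by positivity).trans ?_
  apply ENNReal.ofReal_le_ofReal
  have hdiv : ((N ^ 2 / 100 : ℕ) : ℝ) ≤ (N : ℝ) ^ 2 / 100 := by
    have := Nat.cast_div_le (α := ℝ) (m := N ^ 2) (n := 100)
    push_cast at this; exact this
  have hterm : ∀ n : ℕ, n ∈ Finset.Icc 1 (N ^ 2 / 100) →
      (2 * (n : ℝ) * (ρ / 2 + 1 / ((n : ℝ) * N)) + 1) ^ 2 * (2 * (1 / ((n : ℝ) * N))) ^ 2 ≤
      8 * ρ ^ 2 / (N : ℝ) ^ 2 + 72 / (N : ℝ) ^ 2 * ((n : ℝ) ^ 2)⁻¹ := by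
    intro n hn
    have hn1 : (1 : ℝ) ≤ n := by exact_mod_cast (Finset.mem_Icc.1 hn).1
    have hn0 : (0 : ℝ) < n := by linarith
    have e1 : 2 * (n : ℝ) * (ρ / 2 + 1 / ((n : ℝ) * N)) + 1 = n * ρ + 2 / N + 1 := by
      field_simp
    have e2 : 2 / (N : ℝ) ≤ 2 := div_le_self (by norm_num) hN1
    rw [e1]
    calc (n * ρ + 2 / N + 1) ^ 2 * (2 * (1 / ((n : ℝ) * N))) ^ 2
        ≤ (n * ρ + 2 + 1) ^ 2 * (2 * (1 / ((n : ℝ) * N))) ^ 2 := by gcongr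
      _ ≤ (2 * (n * ρ) ^ 2 + 18) * (2 * (1 / ((n : ℝ) * N))) ^ 2 := by
          gcongr
          nlinarith [sq_nonneg (n * ρ - 3)]
      _ = _ := by field_simp; ring
  refine (Finset.sum_le_sum hterm).trans ?_
  rw [Finset.sum_add_distrib, Finset.sum_const, Nat.card_Icc, nsmul_eq_mul, Nat.add_sub_cancel,
    ← Finset.mul_sum]
  have h3 : ∑ n ∈ Finset.Icc (1 : ℕ) (N ^ 2 / 100), ((n : ℝ) ^ 2)⁻¹ ≤ 2 := by
    have := sum_Ioo_inv_sq_le (α := ℝ) 0 (N ^ 2 / 100 + 1)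
    have e : Finset.Ioo 0 (N ^ 2 / 100 + 1) = Finset.Icc 1 (N ^ 2 / 100) := by
      ext; simp only [Finset.mem_Ioo, Finset.mem_Icc]; omega
    rw [e] at this
    simpa using this
  calc _ ≤ (N : ℝ) ^ 2 / 100 * (8 * ρ ^ 2 / (N : ℝ) ^ 2) + 72 / (N : ℝ) ^ 2 * 2 := by gcongr
    _ = 0.08 * ρ ^ 2 + 144 / (N : ℝ) ^ 2 := by field_simp; ring
    _ ≤ _ := by nlinarith [sq_nonneg ρ]

/-- The set of points which are `2ψ`-close to a rational point of denominator at least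
`1 / (2ψ(q))` other than `v / q`. -/
def nearOtherRational (ψ : ℕ → ℝ) (v : Fin 2 → ℤ) (q : ℕ) : Set (Fin 2 → ℝ) :=
  {x | ∃ (n : ℕ) (p : Fin 2 → ℤ), 1 ≤ n ∧ 1 ≤ 2 * ψ q * n ∧ ratPt p n ≠ ratPt v q ∧
    dist x (ratPt p n) ≤ 2 * (ψ n / n)}

/-- Monotonicity of `nψ(n)` bounds the radius `2ψ(n)/n` by `2qψ(q)/n²`, so the areas are at most
`16(qψ(q))²/n⁴` and `exists_local_tsum_le` sums them. -/
theorem exists_volume_nearOtherRational_le : ∃ C : ℝ, 0 < C ∧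
    ∀ (ψ : ℕ → ℝ) (v : Fin 2 → ℤ) (q : ℕ), (∀ n, 1 ≤ n → 0 < ψ n) →
    (∀ m n : ℕ, 1 ≤ m → m ≤ n → n * ψ n ≤ m * ψ m) → 1 ≤ q → IsPrimitive v q →
    4 * q * ψ q ≤ 1 →
    volume (Metric.closedBall (ratPt v q) (ψ q / q) ∩ nearOtherRational ψ v q) ≤
      ENNReal.ofReal (C * (q * ψ q) ^ 2 * (ψ q / q) ^ 2) := by
  obtain ⟨C, hC, hsum⟩ := exists_local_tsum_le
  refine ⟨16 * C, by positivity, fun ψ v q hpos hmono hq hprim hsmall => ?_⟩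
  have hq0 : (0 : ℝ) < q := by exact_mod_cast hq
  have hψ := hpos q hq
  have hloc := hsum v q (ψ q) hq hprim hψ hsmall
  set S := {k : (Fin 2 → ℤ) × ℕ // 1 ≤ k.2 ∧ ratPt k.1 k.2 ≠ ratPt v q ∧
      dist (ratPt k.1 k.2) (ratPt v q) ≤ 2 * (ψ q / q)}
  let R : ℕ → ℝ := fun n => 2 * (q * ψ q / (n : ℝ) ^ 2)
  have hR : ∀ n, 0 ≤ R n := fun n => by positivity
  have hsub : Metric.closedBall (ratPt v q) (ψ q / q) ∩ nearOtherRational ψ v q ⊆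
      ⋃ k : S, Metric.closedBall (ratPt k.1.1 k.1.2) (R k.1.2) := by
    rintro x ⟨hx, n, p, hn, hnq, hne, hd⟩
    have hn0 : (0 : ℝ) < n := by exact_mod_cast hn
    have h2q : 2 * (q : ℝ) ≤ n := by
      by_contra! hc
      nlinarith
    have hle : ψ n / n ≤ q * ψ q / (n : ℝ) ^ 2 := by
      rw [div_le_div_iff₀ hn0 (by positivity)]
      have h1 : q ≤ n := by
        have : (q : ℝ) ≤ n := by linarith
        exact_mod_cast this
      nlinarith [hmono q n hq h1]
    have hle2 : q * ψ q / (n : ℝ) ^ 2 ≤ (ψ q / q) / 4 := by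
      rw [div_div, div_le_div_iff₀ (by positivity) (by positivity)]
      have : 4 * (q : ℝ) ^ 2 ≤ (n : ℝ) ^ 2 := by nlinarith
      nlinarith
    refine mem_iUnion.2 ⟨⟨(p, n), hn, hne, ?_⟩, ?_⟩
    · have h1 := dist_triangle_left (ratPt p n) (ratPt v q) x
      have h2 : 0 < ψ q / q := by positivity
      rw [Metric.mem_closedBall] at hx
      simp only
      linarith
    · rw [Metric.mem_closedBall]
      simp only [R]
      linarith
  refine (measure_mono hsub).trans ((measure_iUnion_le _).trans ?_)
  have hterm : ∀ k : S, volume (Metric.closedBall (ratPt k.1.1 k.1.2) (R k.1.2)) =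
      ENNReal.ofReal (16 * (q * ψ q) ^ 2) * ENNReal.ofReal (1 / (k.1.2 : ℝ) ^ 4) := fun k => by
    rw [Real.volume_pi_closedBall _ (hR _), ← ENNReal.ofReal_mul (by positivity), Fintype.card_fin]
    congr 1
    simp only [R]
    ring
  simp only [hterm]
  rw [ENNReal.tsum_mul_left]
  calc _ ≤ ENNReal.ofReal (16 * (q * ψ q) ^ 2) * ENNReal.ofReal (C * (ψ q / q) ^ 2) := by gcongr
    _ = _ := by rw [← ENNReal.ofReal_mul (by positivity)]; congr 1; ring

/-! ### Weight of a cover and its localisation -/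

/-- The `s`-weight of those balls of the family that meet `I`. -/
noncomputable def ballWeight (c : ℕ → Fin 2 → ℝ) (δ : ℕ → ℝ) (s : ℝ) (I : Set (Fin 2 → ℝ)) :
    ℝ≥0∞ :=
  ∑' i : {i | (Metric.closedBall (c i) (δ i) ∩ I).Nonempty}, ENNReal.ofReal (δ i ^ s)

theorem ofReal_rpow_le_ballWeight {c : ℕ → Fin 2 → ℝ} {δ : ℕ → ℝ} {s : ℝ} {I : Set (Fin 2 → ℝ)}
    {i : ℕ} (hi : (Metric.closedBall (c i) (δ i) ∩ I).Nonempty) :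
    ENNReal.ofReal (δ i ^ s) ≤ ballWeight c δ s I :=
  ENNReal.le_tsum (f := fun i : {i | (Metric.closedBall (c i) (δ i) ∩ I).Nonempty} =>
    ENNReal.ofReal (δ i ^ s)) ⟨i, hi⟩

/-- Markov's inequality for `F = Σ ω_i 1_{B(c_i, δ_i + h)}` with truncated weights `ω_i = min(1,
δ_i^s / w)`. Where `F < 1`, no ball of weight `w` or more comes within `h`, and the others that do
weigh at most `w` together. Truncation keeps `∫ F` small: `ω_i ≤ 1` handles the term `δ_i²`, and
`ω_i ≤ δ_i^s / w` the term `h²`. -/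
theorem exists_ballWeight_exceptional_set {c : ℕ → Fin 2 → ℝ} {δ : ℕ → ℝ} (hδ : ∀ i, 0 < δ i)
    {s κ ρ w h : ℝ} (hs : 0 < s) (hs2 : s ≤ 2) (hκ0 : 0 < κ) (hκ : κ ≤ 1) (hρ : 0 < ρ)
    (hw : 0 < w) (hh : 0 < h) {I : Set (Fin 2 → ℝ)}
    (hI : ballWeight c δ s I ≤ ENNReal.ofReal (κ * ρ ^ s)) :
    ∃ B : Set (Fin 2 → ℝ),
      volume B ≤ ENNReal.ofReal (8 * κ * ρ ^ 2 + 8 * κ * (h ^ 2 * ρ ^ s / w)) ∧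
      ∀ x ∉ B, ∀ I' ⊆ I, I' ⊆ Metric.closedBall x h →
        ballWeight c δ s I' ≤ ENNReal.ofReal w := by
  set J : Set ℕ := {i | (Metric.closedBall (c i) (δ i) ∩ I).Nonempty} with hJ
  let ω : ℕ → ℝ := fun i => min 1 (δ i ^ s / w)
  have hω : ∀ i, 0 ≤ ω i := fun i => by have := hδ i; positivity
  let F : (Fin 2 → ℝ) → ℝ≥0∞ := fun x => ∑' i : J, ENNReal.ofReal (ω i) *
    (Metric.closedBall (c i) (δ i + h)).indicator 1 x
  have hmeas : ∀ i : J, Measurable fun x : Fin 2 → ℝ => ENNReal.ofReal (ω i) *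
      (Metric.closedBall (c i) (δ i + h)).indicator (1 : (Fin 2 → ℝ) → ℝ≥0∞) x := fun i =>
    (measurable_one.indicator Metric.isClosed_closedBall.measurableSet).const_mul _
  refine ⟨{x | 1 ≤ F x}, ?_, ?_⟩
  · have hF : Measurable F := Measurable.tsum hmeas
    have h1 : volume {x | 1 ≤ F x} ≤ ∫⁻ x, F x := by
      simpa using mul_meas_ge_le_lintegral hF 1
    refine h1.trans ?_
    rw [lintegral_tsum fun i => (hmeas i).aemeasurable]
    have hterm : ∀ i : J, ∫⁻ x, ENNReal.ofReal (ω i) *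
        (Metric.closedBall (c i) (δ i + h)).indicator (1 : (Fin 2 → ℝ) → ℝ≥0∞) x ≤
        ENNReal.ofReal (8 * (ρ ^ (2 - s) + h ^ 2 / w)) * ENNReal.ofReal (δ i ^ s) := by
      rintro ⟨i, hi⟩
      have hδi := hδ i
      -- A single ball weighs no more than the whole family; with `s ≤ 2` this gives `δ² ≤ ρ^(2-s)
      -- δ^s` below.
      have hle : δ i ≤ ρ := by
        have h2 := (ofReal_rpow_le_ballWeight (s := s) hi).trans hI
        rw [ENNReal.ofReal_le_ofReal_iff (by positivity)] at h2
        have h3 : κ * ρ ^ s ≤ ρ ^ s := mul_le_of_le_one_left (by positivity) hκ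
        exact (Real.rpow_le_rpow_iff hδi.le hρ.le hs).1 (h2.trans h3)
      rw [lintegral_const_mul _
        (measurable_one.indicator Metric.isClosed_closedBall.measurableSet),
        lintegral_indicator_one Metric.isClosed_closedBall.measurableSet,
        Real.volume_pi_closedBall _ (by positivity), Fintype.card_fin,
        ← ENNReal.ofReal_mul (hω i), ← ENNReal.ofReal_mul (by positivity)]
      apply ENNReal.ofReal_le_ofReal
      have e1 : (2 * (δ i + h)) ^ 2 ≤ 8 * (δ i ^ 2 + h ^ 2) := by nlinarith [sq_nonneg (δ i - h)]
      have e2 : δ i ^ 2 ≤ ρ ^ (2 - s) * δ i ^ s := by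
        calc δ i ^ 2 = δ i ^ (2 - s) * δ i ^ s := by
              rw [← Real.rpow_add hδi, ← Real.rpow_two]; congr 1; ring
          _ ≤ _ := by gcongr
      calc ω i * (2 * (δ i + h)) ^ 2 ≤ ω i * (8 * (δ i ^ 2 + h ^ 2)) := by gcongr
        _ = 8 * (ω i * δ i ^ 2 + ω i * h ^ 2) := by ring
        _ ≤ 8 * (1 * (ρ ^ (2 - s) * δ i ^ s) + δ i ^ s / w * h ^ 2) := by
            gcongr
            · exact min_le_left _ _
            · exact min_le_right _ _
        _ = _ := by ring
    refine (ENNReal.tsum_le_tsum hterm).trans ?_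
    rw [ENNReal.tsum_mul_left]
    calc _ ≤ ENNReal.ofReal (8 * (ρ ^ (2 - s) + h ^ 2 / w)) * ENNReal.ofReal (κ * ρ ^ s) := by
          gcongr; exact hI
      _ = _ := by
          rw [← ENNReal.ofReal_mul (by positivity)]
          congr 1
          have e : ρ ^ (2 - s) * ρ ^ s = ρ ^ 2 := by
            rw [← Real.rpow_add hρ, ← Real.rpow_two]; congr 1; ring
          linear_combination 8 * κ * e
  · intro x hx I' hI' hI'x
    rw [mem_ofPred_eq, not_le] at hx
    set J' : Set ℕ := {i | (Metric.closedBall (c i) (δ i) ∩ I').Nonempty} with hJ'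
    have hsub : J' ⊆ J := fun i hi => hi.mono (inter_subset_inter_right _ hI')
    have hind : ∀ i ∈ J', (Metric.closedBall (c i) (δ i + h)).indicator
        (1 : (Fin 2 → ℝ) → ℝ≥0∞) x = 1 := by
      rintro i ⟨y, hy1, hy2⟩
      rw [indicator_of_mem, Pi.one_apply]
      have h1 := Metric.mem_closedBall.1 (hI'x hy2)
      have h2 := Metric.mem_closedBall.1 hy1
      rw [Metric.mem_closedBall]
      linarith [dist_triangle_left x (c i) y]
    have hterm : ∀ i ∈ J', ENNReal.ofReal (δ i ^ s) = ENNReal.ofReal w * (ENNReal.ofReal (ω i) *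
        (Metric.closedBall (c i) (δ i + h)).indicator 1 x) := by
      intro i hi
      have h1 : ENNReal.ofReal (ω i) * (Metric.closedBall (c i) (δ i + h)).indicator 1 x ≤ F x :=
        ENNReal.le_tsum (f := fun i : J => ENNReal.ofReal (ω i) *
          (Metric.closedBall (c i) (δ i + h)).indicator 1 x) ⟨i, hsub hi⟩
      have h2 := h1.trans_lt hx
      rw [hind i hi, mul_one] at h2 ⊢
      have h3 : ω i < 1 := by simpa [ENNReal.ofReal_lt_one] using h2
      have h4 : ω i = δ i ^ s / w := by
        rcases min_choice 1 (δ i ^ s / w) with h5 | h5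
        · exact absurd h5 h3.ne
        · exact h5
      rw [← ENNReal.ofReal_mul hw.le, h4]
      congr 1
      field_simp
    calc ballWeight c δ s I' = ∑' i : J', ENNReal.ofReal w * (ENNReal.ofReal (ω i) *
          (Metric.closedBall (c i) (δ i + h)).indicator 1 x) :=
          tsum_congr fun i => hterm i i.2
      _ = ENNReal.ofReal w * ∑' i : J', ENNReal.ofReal (ω i) *
          (Metric.closedBall (c i) (δ i + h)).indicator 1 x := ENNReal.tsum_mul_left
      _ ≤ ENNReal.ofReal w * F x := by
          gcongr
          exact ENNReal.tsum_mono_subtype (fun i => ENNReal.ofReal (ω i) *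
            (Metric.closedBall (c i) (δ i + h)).indicator 1 x) hsub
      _ ≤ ENNReal.ofReal w * 1 := by gcongr
      _ = _ := mul_one _

/-! ### Boxes in annuli around rational points -/

/-- A box contained in the annulus of relative width `η` around `v / q` with outer radius
`ψ(q) / q`. -/
noncomputable def annulusBox (ψ : ℕ → ℝ) (η : ℝ) (v : Fin 2 → ℤ) (q : ℕ) : Set (Fin 2 → ℝ) :=
  Metric.closedBall (fun i => (v i : ℝ) / q + (1 - η / 2) * (ψ q / q)) (η / 4 * (ψ q / q))

theorem coord_mem_of_mem_annulusBox {ψ : ℕ → ℝ} {η : ℝ} {v : Fin 2 → ℤ} {q : ℕ}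
    {y : Fin 2 → ℝ} (hy : y ∈ annulusBox ψ η v q) (i : Fin 2) :
    (1 - 3 * η / 4) * (ψ q / q) ≤ y i - ratPt v q i ∧
      y i - ratPt v q i ≤ (1 - η / 4) * (ψ q / q) := by
  have h := (dist_le_pi_dist _ _ i).trans (Metric.mem_closedBall.1 hy)
  rw [Real.dist_eq, abs_le] at h
  simp only [ratPt]
  constructor <;> linarith [h.1, h.2]

theorem le_dist_of_mem_annulusBox {ψ : ℕ → ℝ} {η : ℝ} {v : Fin 2 → ℤ} {q : ℕ}
    {y : Fin 2 → ℝ} (hη : 0 ≤ η) (hr : 0 ≤ ψ q / q) (hy : y ∈ annulusBox ψ η v q) :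
    (1 - η) * (ψ q / q) ≤ dist y (ratPt v q) := by
  refine le_trans ?_ (dist_le_pi_dist _ _ 0)
  rw [Real.dist_eq]
  refine le_trans ?_ (le_abs_self _)
  nlinarith [(coord_mem_of_mem_annulusBox hy 0).1, mul_nonneg hη hr]

theorem dist_le_of_mem_annulusBox {ψ : ℕ → ℝ} {η : ℝ} {v : Fin 2 → ℤ} {q : ℕ}
    {y : Fin 2 → ℝ} (hη1 : η ≤ 1) (hr : 0 ≤ ψ q / q)
    (hy : y ∈ annulusBox ψ η v q) :
    dist y (ratPt v q) ≤ (1 - η / 4) * (ψ q / q) := by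
  rw [dist_pi_le_iff (mul_nonneg (by linarith) hr)]
  intro i
  have h := coord_mem_of_mem_annulusBox hy i
  rw [Real.dist_eq, abs_le]
  exact ⟨by nlinarith, h.2⟩

/-- `v / q` is a primitive rational point around which an annulus of relative width `η` is not
exhausted by the neighbourhoods of other rational points. -/
structure IsStage (ψ : ℕ → ℝ) (A η : ℝ) (v : Fin 2 → ℤ) (q : ℕ) : Prop where
  one_le : 1 ≤ q
  prim : IsPrimitive v q
  small : 4 * q * ψ q ≤ 1
  sq_le : A * (q * ψ q) ^ 2 ≤ η ^ 2

theorem eventually_const_div_pow_le (c : ℝ) {ε : ℝ} (hε : 0 < ε) {k : ℕ} (hk : k ≠ 0) :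
    ∀ᶠ N : ℕ in atTop, c / (N : ℝ) ^ k ≤ ε := by
  have h : Tendsto (fun N : ℕ => c / (N : ℝ) ^ k) atTop (nhds 0) :=
    tendsto_const_nhds.div_atTop ((tendsto_pow_atTop hk).comp tendsto_natCast_atTop_atTop)
  exact h.eventually_le_const hε

/-- The two centres are handled by their annuli: a primitive denominator is least, so any other
representation has a smaller `ψ(n)/n`. Other points with `n ≤ K` are excluded by `hfar`. For `n >
K`, the separation `1/(q'n)` from `v'/q'` exceeds `ψ(n)/n + ψ(q')/q'`, as `q'ψ(n) ≤ 1/2` and `nψ(q')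
< 1/2`. -/
theorem le_dist_ratPt_of_mem_annulusBox {ψ : ℕ → ℝ} (hpos : ∀ n, 1 ≤ n → 0 < ψ n)
    (hmono : ∀ m n : ℕ, 1 ≤ m → m ≤ n → n * ψ n ≤ m * ψ m) {η η' : ℝ}
    (hη : 0 ≤ η) (hη1 : η ≤ 1) (hη' : 0 ≤ η') (hη1' : η' ≤ 1)
    {v v' : Fin 2 → ℤ} {q q' : ℕ} (hq1 : 1 ≤ q) (hq1' : 1 ≤ q') (hprim : IsPrimitive v q)
    (hprim' : IsPrimitive v' q') {y : Fin 2 → ℝ} (hy : y ∈ annulusBox ψ η v q)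
    (hy' : y ∈ annulusBox ψ η' v' q') {K : ℕ}
    (hfar : ∀ (n : ℕ) (p : Fin 2 → ℤ), 1 ≤ n → n ≤ K → 1 ≤ 2 * ψ q * n →
      ratPt p n ≠ ratPt v q → ψ n / n ≤ dist y (ratPt p n))
    (hK : ∀ n, K < n → q' * ψ n ≤ 1 / 2) (n : ℕ) (p : Fin 2 → ℤ) (hn : 1 ≤ n)
    (hnq : 1 ≤ 2 * ψ q * n) (hnq' : 2 * ψ q' * n < 1) :
    (1 - max η η') * (ψ n / n) ≤ dist y (ratPt p n) := by
  have hq0 : (0 : ℝ) < q := by exact_mod_cast hq1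
  have hr0 : 0 < ψ q / q := div_pos (hpos q hq1) hq0
  have hq0' : (0 : ℝ) < q' := by exact_mod_cast hq1'
  have hr0' : 0 < ψ q' / q' := div_pos (hpos q' hq1') hq0'
  have hn0 : (0 : ℝ) < n := by exact_mod_cast hn
  have hψn := hpos n hn
  have hrn : 0 < ψ n / n := by positivity
  have hquot : ∀ m : ℕ, 1 ≤ m → m ≤ n → ψ n / n ≤ ψ m / m := by
    intro m hm hmn
    have hm0 : (0 : ℝ) < m := by exact_mod_cast hm
    have hmn' : (m : ℝ) ≤ n := by exact_mod_cast hmn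
    have e := hmono m n hm hmn
    have : ψ n ≤ ψ m := by
      by_contra! hc
      nlinarith [hpos m hm]
    exact div_le_div₀ (hpos m hm).le this hm0 hmn'
  have hmaxle : max η η' ≤ 1 := max_le hη1 hη1'
  have hle1 : (1 - max η η') * (ψ n / n) ≤ ψ n / n :=
    mul_le_of_le_one_left hrn.le (by linarith [le_max_left η η'])
  by_cases hv' : ratPt p n = ratPt v' q'
  · have h1 := hquot q' hq1' (hprim'.le_of_ratPt_eq hq1' hn hv')
    rw [hv']
    refine le_trans ?_ (le_dist_of_mem_annulusBox hη' hr0'.le hy')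
    exact mul_le_mul (by linarith [le_max_right η η']) h1 hrn.le (by linarith)
  by_cases hv : ratPt p n = ratPt v q
  · have h1 := hquot q hq1 (hprim.le_of_ratPt_eq hq1 hn hv)
    rw [hv]
    refine le_trans ?_ (le_dist_of_mem_annulusBox hη hr0.le hy)
    exact mul_le_mul (by linarith [le_max_left η η']) h1 hrn.le (by linarith)
  refine hle1.trans ?_
  by_cases hnN : n ≤ K
  · exact hfar n p hn hnN hnq hv
  · have h1 := one_div_le_dist_ratPt hq1' hn hv'
    have h2 := dist_le_of_mem_annulusBox hη1' hr0'.le hy'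
    have h3 := dist_triangle_left (ratPt p n) (ratPt v' q') y
    have h5 := hK n (not_le.1 hnN)
    have h6 : ψ n / n + ψ q' / q' ≤ 1 / ((q' : ℝ) * n) := by
      rw [div_add_div _ _ hn0.ne' hq0'.ne', mul_comm (q' : ℝ) n]
      gcongr
      linarith
    nlinarith

theorem rpow_le_div_of_le_sq {ψ : ℕ → ℝ} {τ : ℝ} (hτ : 0 ≤ τ) {N q : ℕ} (hq : 1 ≤ q)
    (hqN : (q : ℝ) ≤ (N : ℝ) ^ 2) (hψ : (q : ℝ) ^ (-τ) ≤ ψ q) :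
    (N : ℝ) ^ (-(2 * (τ + 1))) ≤ ψ q / q := by
  have hq0 : (0 : ℝ) < q := by exact_mod_cast hq
  calc (N : ℝ) ^ (-(2 * (τ + 1))) = ((N : ℝ) ^ 2) ^ (-(τ + 1)) := by
        rw [← Real.rpow_two, ← Real.rpow_mul N.cast_nonneg]; congr 1; ring
    _ ≤ (q : ℝ) ^ (-(τ + 1)) := Real.rpow_le_rpow_of_nonpos hq0 hqN (by linarith)
    _ = (q : ℝ) ^ (-τ) / q := by
        rw [← Real.rpow_sub_one hq0.ne']; congr 1; ring
    _ ≤ _ := by gcongr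

theorem div_le_hundred_div_cube {N q x : ℝ} (hN : 1000 ≤ N) (hq : 0 < q) (hqN : N ^ 2 < 100 * q)
    (hx : q * x ≤ 1 / 2000) : x / q ≤ 100 / N ^ 3 := by
  have hN0 : 0 < N := by linarith
  rw [div_le_div_iff₀ hq (by positivity)]
  refine le_of_mul_le_mul_left ?_ hq
  have h1 : (N ^ 2) ^ 2 ≤ (100 * q) ^ 2 := by gcongr
  have h2 : 1000 * N ^ 3 ≤ (N ^ 2) ^ 2 := by
    have : 0 < N ^ 3 := by positivity
    nlinarith
  calc q * (x * N ^ 3) = q * x * N ^ 3 := by ring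
    _ ≤ 1 / 2000 * N ^ 3 := by gcongr
    _ ≤ _ := by linarith [sq_nonneg q]

/-! ### The inductive step -/

set_option maxHeartbeats 800000 in
-- Four bad sets, each of area at most `ρ²/5`, cannot fill the concentric half-size box of area
-- `ρ²`. A point `x` outside them is approximated by Dirichlet's theorem, and the new box fits into
-- the ball of radius `h = 200/N³` around `x`.
theorem exists_next_isStage {C : ℝ}
    (hC : ∀ (ψ : ℕ → ℝ) (v : Fin 2 → ℤ) (q : ℕ), (∀ n, 1 ≤ n → 0 < ψ n) →
      (∀ m n : ℕ, 1 ≤ m → m ≤ n → n * ψ n ≤ m * ψ m) → 1 ≤ q → IsPrimitive v q →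
      4 * q * ψ q ≤ 1 →
      volume (Metric.closedBall (ratPt v q) (ψ q / q) ∩ nearOtherRational ψ v q) ≤
        ENNReal.ofReal (C * (q * ψ q) ^ 2 * (ψ q / q) ^ 2))
    {ψ : ℕ → ℝ} (hpos : ∀ n, 1 ≤ n → 0 < ψ n)
    (hmono : ∀ m n : ℕ, 1 ≤ m → m ≤ n → n * ψ n ≤ m * ψ m)
    (hzero : Tendsto (fun q : ℕ => (q : ℝ) * ψ q) atTop (nhds 0))
    {τ s : ℝ} (hτ0 : 0 ≤ τ) (hτ : ∀ᶠ q : ℕ in atTop, (q : ℝ) ^ (-τ) ≤ ψ q)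
    (hs : 0 < s) (hs2 : s ≤ 2) (hτs : (τ + 1) * s < 3)
    {c : ℕ → Fin 2 → ℝ} {δ : ℕ → ℝ} (hδ : ∀ i, 0 < δ i)
    {η η' : ℝ} (hη : 0 < η) (hη1 : η ≤ 1) (hη' : 0 < η') (hη1' : η' ≤ 1)
    {v : Fin 2 → ℤ} {q : ℕ} (hst : IsStage ψ (80 * C) η v q)
    (hw : ballWeight c δ s (annulusBox ψ η v q) ≤
      ENNReal.ofReal (1 / 1000 * (η / 4 * (ψ q / q)) ^ s)) (L : ℕ) :
    ∃ (v' : Fin 2 → ℤ) (q' : ℕ), L ≤ q' ∧ IsStage ψ (80 * C) η' v' q' ∧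
      annulusBox ψ η' v' q' ⊆ annulusBox ψ η v q ∧
      ballWeight c δ s (annulusBox ψ η' v' q') ≤
        ENNReal.ofReal (1 / 1000 * (η' / 4 * (ψ q' / q')) ^ s) ∧
      ∀ y ∈ annulusBox ψ η' v' q', ∀ (n : ℕ) (p : Fin 2 → ℤ), 1 ≤ n → 1 ≤ 2 * ψ q * n →
        2 * ψ q' * n < 1 → (1 - max η η') * (ψ n / n) ≤ dist y (ratPt p n) := by
  obtain ⟨hq1, hprim, hsmall, hsq⟩ := hst
  have hq0 : (0 : ℝ) < q := by exact_mod_cast hq1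
  have hψq := hpos q hq1
  set r : ℝ := ψ q / q with hr
  have hr0 : 0 < r := by positivity
  set ρ : ℝ := η / 4 * r with hρdef
  have hρ : 0 < ρ := by positivity
  -- the parameter `N`
  have hev : ∀ᶠ N : ℕ in atTop,
      (400 / (N : ℝ) ^ 3 ≤ ρ / 2 ∧ 1280 / (N : ℝ) ^ 4 ≤ ρ ^ 2 / 10 ∧
        144 / (N : ℝ) ^ 2 ≤ ρ ^ 2 / 10) ∧
      -- The `h²ρ^s/w` term of the exceptional set, with `320000 = 8 · 200²`; it tends to 0 because
      -- `(τ+1)s < 3`.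
      320000 * ρ ^ s / (η' / 4) ^ s * (N : ℝ) ^ (-(6 - 2 * (τ + 1) * s)) ≤ ρ ^ 2 / 10 ∧
      -- The constant `1/2000` gives `q'ψ(n) ≤ N²ψ(n) ≤ 1000nψ(n) ≤ 1/2` for `n > N²/1000`.
      ∀ n : ℕ, N ≤ n → n * ψ n ≤ 1 / 2000 ∧ 80 * C * (n * ψ n) ^ 2 ≤ η' ^ 2 ∧
        (n : ℝ) ^ (-τ) ≤ ψ n := by
    refine ((eventually_const_div_pow_le _ (by positivity) (by norm_num)).and
      ((eventually_const_div_pow_le _ (by positivity) (by norm_num)).and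
        (eventually_const_div_pow_le _ (by positivity) (by norm_num)))).and (Eventually.and ?_ ?_)
    · have h : Tendsto (fun N : ℕ => 320000 * ρ ^ s / (η' / 4) ^ s *
          (N : ℝ) ^ (-(6 - 2 * (τ + 1) * s))) atTop
          (nhds (320000 * ρ ^ s / (η' / 4) ^ s * 0)) :=
        ((tendsto_rpow_neg_atTop (by linarith)).comp tendsto_natCast_atTop_atTop).const_mul _
      rw [mul_zero] at h
      exact h.eventually_le_const (by positivity)
    · rw [eventually_forall_ge_atTop]
      have h2 : Tendsto (fun q : ℕ => 80 * C * ((q : ℝ) * ψ q) ^ 2) atTop (nhds (80 * C * 0 ^ 2)) :=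
        (hzero.pow 2).const_mul _
      rw [zero_pow two_ne_zero, mul_zero] at h2
      exact (hzero.eventually_le_const (by norm_num)).and
        ((h2.eventually_le_const (by positivity)).and hτ)
  obtain ⟨N₀, hN₀⟩ := eventually_atTop.1 hev
  set M := max N₀ (max L q + 1) with hM
  -- With this factor every denominator above `N²/1000` exceeds `M`, where the tail estimates hold.
  set N := 1000 * M with hN
  have hM1 : 1 ≤ M := by omega
  have hN1 : 1 ≤ N := by omega
  obtain ⟨⟨hN3, hN4, hN2⟩, hNs, -⟩ := hN₀ N (by omega)
  have htail : ∀ n : ℕ, M ≤ n → n * ψ n ≤ 1 / 2000 ∧ 80 * C * (n * ψ n) ^ 2 ≤ η' ^ 2 ∧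
        (n : ℝ) ^ (-τ) ≤ ψ n := (hN₀ M (le_max_left _ _)).2.2
  have hN0 : (0 : ℝ) < N := by exact_mod_cast hN1
  have hN1000 : (1000 : ℝ) ≤ N := by exact_mod_cast (by omega : 1000 ≤ N)
  have hNM : 1000 * M ≤ N ^ 2 / 1000 := by
    rw [Nat.le_div_iff_mul_le (by norm_num), hN]; nlinarith
  clear_value M N
  set h : ℝ := 200 / (N : ℝ) ^ 3 with hh
  have hh0 : 0 < h := by positivity
  set ρ' : ℝ := η' / 4 * (N : ℝ) ^ (-(2 * (τ + 1))) with hρ'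
  have hρ'0 : 0 < ρ' := by positivity
  obtain ⟨B₁, hB₁, hB₁w⟩ := exists_ballWeight_exceptional_set hδ (κ := 1 / 1000)
    (w := 1 / 1000 * ρ' ^ s) (h := h) hs hs2 (by norm_num) (by norm_num) hρ (by positivity) hh0 hw
  set z : Fin 2 → ℝ := fun i => (v i : ℝ) / q + (1 - η / 2) * r with hz
  have hsub : Metric.closedBall z (ρ / 2) ⊆ annulusBox ψ η v q :=
    Metric.closedBall_subset_closedBall (by linarith)
  have hB₁' : volume B₁ ≤ ENNReal.ofReal (ρ ^ 2 / 5) := by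
    refine hB₁.trans (ENNReal.ofReal_le_ofReal ?_)
    have e : 8 * (1 / 1000) * (h ^ 2 * ρ ^ s / (1 / 1000 * ρ' ^ s)) =
        320000 * ρ ^ s / (η' / 4) ^ s * (N : ℝ) ^ (-(6 - 2 * (τ + 1) * s)) := by
      rw [hρ', Real.mul_rpow (x := η' / 4) (by positivity) (by positivity),
        ← Real.rpow_mul hN0.le, hh,
        show -(6 - 2 * (τ + 1) * s) = -(-(2 * (τ + 1)) * s) - (6 : ℕ) by push_cast; ring,
        Real.rpow_sub hN0, Real.rpow_natCast, Real.rpow_neg hN0.le (-(2 * (τ + 1)) * s)]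
      field_simp
      norm_num
    rw [e]
    nlinarith
  have hB₂ : volume (Metric.closedBall z (ρ / 2) ∩ nearOtherRational ψ v q) ≤
      ENNReal.ofReal (ρ ^ 2 / 5) := by
    refine (measure_mono (inter_subset_inter_left _ ?_)).trans
      ((hC ψ v q hpos hmono hq1 hprim hsmall).trans (ENNReal.ofReal_le_ofReal ?_))
    · intro y hy
      have := dist_le_of_mem_annulusBox hη1 hr0.le (hsub hy)
      have h4 := mul_le_of_le_one_left hr0.le (by linarith : 1 - η / 4 ≤ 1)
      rw [Metric.mem_closedBall]
      linarith
    -- This identity is the source of the constant `80 * C` in `IsStage`.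
    · have : ρ ^ 2 / 5 = η ^ 2 / 80 * r ^ 2 := by rw [hρdef]; ring
      rw [this]
      gcongr
      linarith
  have hB₃ := volume_inter_near_small_denominators_le z hρ hN1 hN3 hN4
  have hB₄ := volume_inter_small_dirichlet_denominators_le z hρ hN1 hN2
  set T₃ := {x | ∃ (n : ℕ) (p : Fin 2 → ℤ),
      1 ≤ n ∧ n ≤ N ^ 2 / 1000 ∧ dist x (ratPt p n) ≤ 400 / (N : ℝ) ^ 3}
  set T₄ := {x | ∃ (n : ℕ) (p : Fin 2 → ℤ),
      1 ≤ n ∧ n ≤ N ^ 2 / 100 ∧ dist x (ratPt p n) ≤ 1 / ((n : ℝ) * N)}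
  obtain ⟨x, hx, hx₁, hx₂, hx₃, hx₄⟩ : ∃ x ∈ Metric.closedBall z (ρ / 2), x ∉ B₁ ∧
      x ∉ nearOtherRational ψ v q ∧ x ∉ T₃ ∧ x ∉ T₄ := by
    by_contra! hcon
    have hcov : Metric.closedBall z (ρ / 2) ⊆ B₁ ∪
        (Metric.closedBall z (ρ / 2) ∩ nearOtherRational ψ v q) ∪
        (Metric.closedBall z (ρ / 2) ∩ T₃) ∪ (Metric.closedBall z (ρ / 2) ∩ T₄) := by
      intro x hx
      by_cases h1 : x ∈ B₁
      · exact Or.inl (Or.inl (Or.inl h1))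
      by_cases h2 : x ∈ nearOtherRational ψ v q
      · exact Or.inl (Or.inl (Or.inr ⟨hx, h2⟩))
      by_cases h3 : x ∈ T₃
      · exact Or.inl (Or.inr ⟨hx, h3⟩)
      · exact Or.inr ⟨hx, hcon x hx h1 h2 h3⟩
    have h1 : volume (Metric.closedBall z (ρ / 2)) ≤ ENNReal.ofReal (ρ ^ 2 / 5) +
        ENNReal.ofReal (ρ ^ 2 / 5) + ENNReal.ofReal (ρ ^ 2 / 5) + ENNReal.ofReal (ρ ^ 2 / 5) :=
      (measure_mono hcov).trans ((measure_union_le _ _).trans (add_le_add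
        ((measure_union_le _ _).trans (add_le_add
          ((measure_union_le _ _).trans (add_le_add hB₁' hB₂)) hB₃)) hB₄))
    rw [Real.volume_pi_closedBall _ (by positivity), Fintype.card_fin,
      ← ENNReal.ofReal_add (by positivity) (by positivity),
      ← ENNReal.ofReal_add (by positivity) (by positivity),
      ← ENNReal.ofReal_add (by positivity) (by positivity),
      ENNReal.ofReal_le_ofReal_iff (by positivity)] at h1
    nlinarith [sq_pos_of_pos hρ]
  obtain ⟨v', q', hq1', hqN, hprim', hdist⟩ := exists_ratPt_dist_le x hN1
  have hq0' : (0 : ℝ) < q' := by exact_mod_cast hq1'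
  have hqN' : N ^ 2 / 100 < q' := by
    by_contra! hc
    exact hx₄ ⟨q', v', hq1', hc, hdist⟩
  have hqN100 : (N : ℝ) ^ 2 < 100 * q' := by
    have := (Nat.div_lt_iff_lt_mul (by norm_num)).1 hqN'
    rw [mul_comm] at this
    exact_mod_cast this
  have hqNle : (q' : ℝ) ≤ (N : ℝ) ^ 2 := by exact_mod_cast hqN
  have hMq : M ≤ q' := by
    have : N ^ 2 / 1000 ≤ N ^ 2 / 100 := Nat.div_le_div_left (by norm_num) (by norm_num)
    omega
  obtain ⟨ht1, ht2, ht3⟩ := htail q' hMq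
  have hψq' := hpos q' hq1'
  set r' : ℝ := ψ q' / q' with hr'
  have hr0' : 0 < r' := by positivity
  have hx100 : dist x (ratPt v' q') ≤ 100 / (N : ℝ) ^ 3 := by
    refine hdist.trans ?_
    rw [div_le_div_iff₀ (by positivity) (by positivity)]
    nlinarith
  have hr100 : r' ≤ 100 / (N : ℝ) ^ 3 := div_le_hundred_div_cube hN1000 hq0' hqN100 ht1
  have hball : annulusBox ψ η' v' q' ⊆ Metric.closedBall x h := by
    intro y hy
    have h1 := dist_le_of_mem_annulusBox hη1' hr0'.le hy
    have h2 := dist_triangle_right y x (ratPt v' q')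
    have h3 : h = 100 / (N : ℝ) ^ 3 + 100 / (N : ℝ) ^ 3 := by rw [hh]; ring
    have h4 := mul_le_of_le_one_left hr0'.le (by linarith : 1 - η' / 4 ≤ 1)
    rw [Metric.mem_closedBall, h3]
    linarith
  have hbox : annulusBox ψ η' v' q' ⊆ annulusBox ψ η v q := by
    intro y hy
    have h1 := Metric.mem_closedBall.1 (hball hy)
    have h2 := Metric.mem_closedBall.1 hx
    have h3 := dist_triangle y x z
    have h4 : 400 / (N : ℝ) ^ 3 = 2 * h := by rw [hh]; ring
    rw [annulusBox, Metric.mem_closedBall]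
    change dist y z ≤ ρ
    linarith
  refine ⟨v', q', by omega, ⟨hq1', hprim', by linarith, ht2⟩, hbox, ?_, ?_⟩
  -- Since `q' ≤ N²`, the new box has radius at least `ρ'`, the value for which the weight threshold
  -- was set.
  · have hρle : ρ' ≤ η' / 4 * r' := by
      refine mul_le_mul_of_nonneg_left ?_ (by positivity)
      exact rpow_le_div_of_le_sq hτ0 hq1' hqNle ht3
    exact (hB₁w x hx₁ _ hbox hball).trans (ENNReal.ofReal_le_ofReal
      (mul_le_mul_of_nonneg_left (Real.rpow_le_rpow hρ'0.le hρle hs.le) (by norm_num)))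
  · intro y hy
    refine le_dist_ratPt_of_mem_annulusBox hpos hmono hη.le hη1 hη'.le hη1' hq1 hq1' hprim hprim'
      (hbox hy) hy (K := N ^ 2 / 1000) ?_ ?_
    · intro n p hn hnN hnq hv
      have hn0 : (0 : ℝ) < n := by exact_mod_cast hn
      have hrn : 0 < ψ n / n := div_pos (hpos n hn) hn0
      have h2 : 2 * (ψ n / n) < dist x (ratPt p n) := by
        by_contra! hc
        exact hx₂ ⟨n, p, hn, hnq, hv, hc⟩
      have h3 : 400 / (N : ℝ) ^ 3 < dist x (ratPt p n) := by
        by_contra! hc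
        exact hx₃ ⟨n, p, hn, hnN, hc⟩
      have h4 : 400 / (N : ℝ) ^ 3 = 2 * h := by rw [hh]; ring
      have h5 := Metric.mem_closedBall.1 (hball hy)
      -- The distance from `x` exceeds both `2ψ(n)/n` and `2h`, hence their mean `ψ(n)/n + h`;
      -- passing from `x` to `y` costs at most `h`.
      linarith [dist_triangle_left x (ratPt p n) y]
    · intro n hnN
      have h4 := (htail n (by omega)).1
      have hψn := hpos n (by omega)
      have hnN' : (N : ℝ) ^ 2 < 1000 * n := by
        have := (Nat.div_lt_iff_lt_mul (by norm_num)).1 hnN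
        rw [mul_comm] at this
        exact_mod_cast this
      linarith [mul_le_mul_of_nonneg_right (hqNle.trans hnN'.le) hψn.le]

/-! ### Nested boxes and positivity of Hausdorff measure -/

theorem exists_closedBall_cover_of_hausdorffMeasure_eq_zero {s : ℝ} (hs : 0 < s)
    {S : Set (Fin 2 → ℝ)} (hS : μH[s] S = 0) {ε : ℝ≥0∞} (hε : ε ≠ 0) :
    ∃ (c : ℕ → Fin 2 → ℝ) (δ : ℕ → ℝ), (∀ i, 0 < δ i) ∧
      S ⊆ ⋃ i, Metric.closedBall (c i) (δ i) ∧ ∑' i, ENNReal.ofReal (δ i ^ s) ≤ ε := by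
  have hε2 : ε / 2 ≠ 0 := (ENNReal.half_pos hε).ne'
  rw [Measure.hausdorffMeasure_apply] at hS
  have h1 := (ENNReal.iSup_eq_zero.1 hS) 1
  rw [ENNReal.iSup_eq_zero] at h1
  have h2 := (h1 one_pos).trans_lt (pos_iff_ne_zero.2 hε2)
  simp only [iInf_lt_iff] at h2
  obtain ⟨t, hcov, hdiam, hsum⟩ := h2
  obtain ⟨e, he, hesum⟩ := ENNReal.exists_pos_sum_of_countable hε2 ℕ
  have hfin : ∀ n, Metric.ediam (t n) ≠ ⊤ := fun n => ((hdiam n).trans_lt ENNReal.one_lt_top).ne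
  classical
  -- Sets of diameter zero still need a positive radius; the summable `e n` pay for it.
  let δ : ℕ → ℝ := fun n => max (Metric.ediam (t n)).toReal ((e n : ℝ) ^ s⁻¹)
  have hepos : ∀ n, 0 < (e n : ℝ) ^ s⁻¹ := fun n => Real.rpow_pos_of_pos (he n) _
  refine ⟨fun n => if h : (t n).Nonempty then h.some else 0, δ,
    fun n => lt_max_of_lt_right (hepos n), ?_, ?_⟩
  · intro x hx
    obtain ⟨n, hn⟩ := mem_iUnion.1 (hcov hx)
    have hne : (t n).Nonempty := ⟨x, hn⟩
    refine mem_iUnion.2 ⟨n, ?_⟩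
    simp only [dif_pos hne]
    rw [Metric.mem_closedBall, dist_edist]
    exact le_max_of_le_left (ENNReal.toReal_mono (hfin n)
      (Metric.edist_le_ediam_of_mem hn hne.some_mem))
  · have hterm : ∀ n, ENNReal.ofReal (δ n ^ s) ≤
        (⨆ _ : (t n).Nonempty, Metric.ediam (t n) ^ s) + e n := by
      intro n
      rcases max_choice (Metric.ediam (t n)).toReal ((e n : ℝ) ^ s⁻¹) with h | h
      · refine le_add_right ?_
        simp only [δ, h]
        rcases (t n).eq_empty_or_nonempty with h0 | h0
        · simp [h0, Real.zero_rpow hs.ne']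
        · rw [← ENNReal.ofReal_rpow_of_nonneg ENNReal.toReal_nonneg hs.le,
            ENNReal.ofReal_toReal (hfin n)]
          exact le_iSup (fun _ : (t n).Nonempty => Metric.ediam (t n) ^ s) h0
      · refine le_add_left ?_
        simp only [δ, h]
        rw [← Real.rpow_mul (NNReal.coe_nonneg _), inv_mul_cancel₀ hs.ne', Real.rpow_one,
          ENNReal.ofReal_coe_nnreal]
    calc _ ≤ ∑' n, ((⨆ _ : (t n).Nonempty, Metric.ediam (t n) ^ s) + (e n : ℝ≥0∞)) :=
          ENNReal.tsum_le_tsum hterm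
      _ = _ := ENNReal.tsum_add
      _ ≤ ε / 2 + ε / 2 := add_le_add hsum.le hesum.le
      _ = ε := ENNReal.add_halves ε

/-- No measure is put on a Cantor set: the cover is fixed first, and a single point of the exact set
that escapes it is constructed. -/
theorem hausdorffMeasure_exactApproxPi_ne_zero {ψ : ℕ → ℝ} (hpos : ∀ n, 1 ≤ n → 0 < ψ n)
    (hmono : ∀ m n : ℕ, 1 ≤ m → m ≤ n → n * ψ n ≤ m * ψ m)
    (hzero : Tendsto (fun q : ℕ => (q : ℝ) * ψ q) atTop (nhds 0))
    {τ s : ℝ} (hτ0 : 0 ≤ τ) (hτ : ∀ᶠ q : ℕ in atTop, (q : ℝ) ^ (-τ) ≤ ψ q)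
    (hs : 0 < s) (hs2 : s ≤ 2) (hτs : (τ + 1) * s < 3) :
    μH[s] (exactApproxPi ψ) ≠ 0 := by
  intro hS
  obtain ⟨C, -, hC⟩ := exists_volume_nearOtherRational_le
  -- the width of the annuli at step `k`
  let η : ℕ → ℝ := fun k => 1 / ((k : ℝ) + 1)
  have hη0 : ∀ k, 0 < η k := fun k => by positivity
  have hη1 : ∀ k, η k ≤ 1 := fun k => by
    simp only [η]
    rw [div_le_one (by positivity)]
    linarith [(Nat.cast_nonneg k : (0 : ℝ) ≤ k)]
  have hηanti : Antitone η := fun a b hab => by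
    simp only [η]
    gcongr
  -- the first box
  obtain ⟨q₀, hq₀2, hq₀small, hq₀sq⟩ : ∃ q₀ : ℕ, 2 ≤ q₀ ∧ q₀ * ψ q₀ ≤ 1 / 4 ∧
      80 * C * (q₀ * ψ q₀) ^ 2 ≤ η 0 ^ 2 := by
    have h2 : Tendsto (fun q : ℕ => 80 * C * ((q : ℝ) * ψ q) ^ 2) atTop (nhds (80 * C * 0 ^ 2)) :=
      (hzero.pow 2).const_mul _
    rw [zero_pow two_ne_zero, mul_zero] at h2
    exact ((eventually_ge_atTop 2).and ((hzero.eventually_le_const (by norm_num)).and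
      (h2.eventually_le_const (pow_pos (hη0 0) 2)))).exists
  have hst₀ : IsStage ψ (80 * C) (η 0) (fun _ => 1) q₀ :=
    ⟨by omega, fun m hm => by simpa using hm 0, by linarith, hq₀sq⟩
  have hψ₀ := hpos q₀ (by omega)
  have hq₀0 : (0 : ℝ) < q₀ := by exact_mod_cast (by omega : 0 < q₀)
  have hρ₀ : 0 < η 0 / 4 * (ψ q₀ / q₀) := mul_pos (by linarith [hη0 0]) (by positivity)
  obtain ⟨c, δ, hδ, hcov, hsum⟩ := exists_closedBall_cover_of_hausdorffMeasure_eq_zero hs hS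
    (ε := ENNReal.ofReal (1 / 1000 * (η 0 / 4 * (ψ q₀ / q₀)) ^ s))
    (by rw [Ne, ENNReal.ofReal_eq_zero, not_le]; positivity)
  -- the sequence of boxes
  let Good : ℕ → (Fin 2 → ℤ) × ℕ → Prop := fun k σ => IsStage ψ (80 * C) (η k) σ.1 σ.2 ∧
    ballWeight c δ s (annulusBox ψ (η k) σ.1 σ.2) ≤
      ENNReal.ofReal (1 / 1000 * (η k / 4 * (ψ σ.2 / σ.2)) ^ s)
  have hgood₀ : Good 0 (fun _ => 1, q₀) :=
    ⟨hst₀, (ENNReal.tsum_comp_le_tsum_of_injective Subtype.val_injective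
      (fun i => ENNReal.ofReal (δ i ^ s))).trans hsum⟩
  have hstep : ∀ (k : ℕ) (σ : {σ // Good k σ}), ∃ σ' : {σ // Good (k + 1) σ},
      σ.1.2 < σ'.1.2 ∧
      annulusBox ψ (η (k + 1)) σ'.1.1 σ'.1.2 ⊆ annulusBox ψ (η k) σ.1.1 σ.1.2 ∧
      ∀ y ∈ annulusBox ψ (η (k + 1)) σ'.1.1 σ'.1.2, ∀ (n : ℕ) (p : Fin 2 → ℤ), 1 ≤ n →
        1 ≤ 2 * ψ σ.1.2 * n → 2 * ψ σ'.1.2 * n < 1 →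
        (1 - η k) * (ψ n / n) ≤ dist y (ratPt p n) := by
    rintro k ⟨⟨v, q⟩, hst, hw⟩
    obtain ⟨v', q', hL, hst', hsub, hw', hfar⟩ := exists_next_isStage hC hpos hmono hzero hτ0 hτ
      hs hs2 hτs hδ (hη0 k) (hη1 k) (hη0 (k + 1)) (hη1 (k + 1)) hst hw (q + 1)
    refine ⟨⟨(v', q'), hst', hw'⟩, hL, hsub, ?_⟩
    rwa [max_eq_left (hηanti k.le_succ)] at hfar
  choose next hnext using hstep
  let seq : ∀ k, {σ // Good k σ} := fun k => Nat.rec ⟨_, hgood₀⟩ next k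
  have hseq : ∀ k, seq (k + 1) = next k (seq k) := fun k => rfl
  let Q : ℕ → ℕ := fun k => (seq k).1.2
  let V : ℕ → Fin 2 → ℤ := fun k => (seq k).1.1
  let I : ℕ → Set (Fin 2 → ℝ) := fun k => annulusBox ψ (η k) (V k) (Q k)
  have hQ : StrictMono Q := strictMono_nat_of_lt_succ fun k => (hnext k (seq k)).1
  have hI : ∀ k, I (k + 1) ⊆ I k := fun k => (hnext k (seq k)).2.1
  have hfar : ∀ k, ∀ y ∈ I (k + 1), ∀ (n : ℕ) (p : Fin 2 → ℤ), 1 ≤ n →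
      1 ≤ 2 * ψ (Q k) * n → 2 * ψ (Q (k + 1)) * n < 1 →
      (1 - η k) * (ψ n / n) ≤ dist y (ratPt p n) := fun k => (hnext k (seq k)).2.2
  have hstage : ∀ k, IsStage ψ (80 * C) (η k) (V k) (Q k) := fun k => (seq k).2.1
  have hweight : ∀ k, ballWeight c δ s (I k) ≤
      ENNReal.ofReal (1 / 1000 * (η k / 4 * (ψ (Q k) / Q k)) ^ s) := fun k => (seq k).2.2
  have hQ1 : ∀ k, 1 ≤ Q k := fun k => (hstage k).one_le
  have hQ0 : ∀ k, (0 : ℝ) < Q k := fun k => by exact_mod_cast hQ1 k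
  have hψQ : ∀ k, 0 < ψ (Q k) := fun k => hpos _ (hQ1 k)
  have hr : ∀ k, 0 < ψ (Q k) / Q k := fun k => div_pos (hψQ k) (hQ0 k)
  have hI0 : I 0 = annulusBox ψ (η 0) (fun _ => 1) q₀ := rfl
  clear_value seq
  obtain ⟨x, hx⟩ : (⋂ k, I k).Nonempty := by
    refine IsCompact.nonempty_iInter_of_sequence_nonempty_isCompact_isClosed I hI (fun k => ?_)
      (isCompact_closedBall _ _) fun k => Metric.isClosed_closedBall
    exact Metric.nonempty_closedBall.2 (mul_nonneg (by linarith [hη0 k]) (hr k).le)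
  rw [mem_iInter] at hx
  have hxmem : x ∈ exactApproxPi ψ := by
    refine ⟨⟨fun i => ?_, ?_⟩, ?_⟩
    · have h1 := coord_mem_of_mem_annulusBox (hI0 ▸ hx 0) i
      have hr₀ : 0 < ψ q₀ / q₀ := by positivity
      have hq2 : (2 : ℝ) ≤ q₀ := by exact_mod_cast hq₀2
      have hr₀1 : ψ q₀ / q₀ ≤ 1 / 2 := by
        rw [div_le_iff₀ hq₀0]
        nlinarith
      have hinv : ratPt (fun _ => 1) q₀ i ≤ 1 / 2 := by
        simp only [ratPt, Int.cast_one]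
        gcongr
      have hinv0 : 0 ≤ ratPt (fun _ => 1) q₀ i := by
        simp only [ratPt, Int.cast_one]
        positivity
      have h2 : 0 ≤ (1 - 3 * η 0 / 4) * (ψ q₀ / q₀) :=
        mul_nonneg (by linarith [hη1 0]) hr₀.le
      have h3 : (1 - η 0 / 4) * (ψ q₀ / q₀) ≤ ψ q₀ / q₀ :=
        mul_le_of_le_one_left hr₀.le (by linarith [hη0 0])
      exact ⟨by linarith [h1.1], by linarith [h1.2]⟩
    · refine infinite_of_injective_forall_mem hQ.injective fun k => ⟨hQ1 k, fun i => ?_⟩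
      have h1 := (dist_le_pi_dist _ _ i).trans (dist_le_of_mem_annulusBox (hη1 k) (hr k).le (hx k))
      rw [Real.dist_eq] at h1
      have h2 : (1 - η k / 4) * (ψ (Q k) / Q k) < ψ (Q k) / Q k :=
        mul_lt_of_lt_one_left (hr k) (by linarith [hη0 k])
      have h3 := h1.trans_lt h2
      rw [lt_div_iff₀ (hQ0 k)] at h3
      refine (round_le _ (V k i)).trans_lt (lt_of_eq_of_lt ?_ h3)
      rw [← abs_of_pos (hQ0 k), ← abs_mul, abs_of_pos (hQ0 k)]
      congr 1
      have := (hQ0 k).ne'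
      simp only [ratPt]
      field_simp
    · simp only [mem_iUnion, not_exists]
      rintro a ⟨ha0, ha1⟩ ⟨-, hinf⟩
      obtain ⟨K, hK⟩ := exists_nat_one_div_lt (sub_pos.2 ha1)
      obtain ⟨n, ⟨hn1, hn⟩, hnK⟩ := hinf.exists_gt ⌈1 / (2 * ψ (Q K))⌉₊
      have hn0 : (0 : ℝ) < n := by exact_mod_cast hn1
      have hnK' : 1 ≤ 2 * ψ (Q K) * n := by
        have h1 : 1 / (2 * ψ (Q K)) ≤ n := (Nat.le_ceil _).trans (by exact_mod_cast hnK.le)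
        rw [div_le_iff₀ (by linarith [hψQ K])] at h1
        linarith
      -- The windows `1/(2ψ(Q k)) ≤ n < 1/(2ψ(Q (k+1)))` with `k ≥ K` catch every `n` from `1/(2ψ(Q
      -- K))` on: once `n ≤ Q m`, the stage bound gives `2ψ(Q m)n ≤ 1/2`.
      obtain ⟨k, hKk, hk1, hk2⟩ : ∃ k, K ≤ k ∧ 1 ≤ 2 * ψ (Q k) * n ∧
          2 * ψ (Q (k + 1)) * n < 1 := by
        by_contra! hcon
        have hall : ∀ k, K ≤ k → 1 ≤ 2 * ψ (Q k) * n := fun k hk =>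
          Nat.le_induction hnK' (fun k hk ih => hcon k hk ih) k hk
        have h1 := hall (max K n) (le_max_left _ _)
        have h2 := (hstage (max K n)).small
        have h3 : (n : ℝ) ≤ Q (max K n) := by
          exact_mod_cast (le_max_right K n).trans (hQ.id_le _)
        have h4 := mul_le_mul_of_nonneg_left h3 (hψQ (max K n)).le
        linarith
      have hf := hfar k x (hx (k + 1)) n (fun i => round ((n : ℝ) * x i)) hn1 hk1 hk2
      have hψn := hpos n hn1
      have hlt : dist x (ratPt (fun i => round ((n : ℝ) * x i)) n) < a * (ψ n / n) := by
        rw [dist_pi_lt_iff (by positivity)]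
        intro i
        have h1 := hn i
        rw [distNearestInt] at h1
        rw [Real.dist_eq, ← mul_div_assoc, lt_div_iff₀ hn0]
        refine lt_of_eq_of_lt ?_ h1
        rw [← abs_of_pos hn0, ← abs_mul, abs_of_pos hn0]
        congr 1
        simp only [ratPt]
        field_simp
      have h5 : η k ≤ 1 - a := (hηanti hKk).trans hK.le
      have h6 : a * (ψ n / n) ≤ (1 - η k) * (ψ n / n) :=
        mul_le_mul_of_nonneg_right (by linarith) (by positivity)
      linarith
  obtain ⟨i, hi⟩ := mem_iUnion.1 (hcov hxmem)
  -- Box `k` has radius at most `η k / 4 < δ i`, yet it meets ball `i`, whose weight alone exceeds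
  -- what the box allows.
  obtain ⟨k, hk⟩ := exists_nat_one_div_lt (hδ i)
  have h1 := (ofReal_rpow_le_ballWeight (s := s) ⟨x, hi, hx k⟩).trans (hweight k)
  have hρ : 0 < η k / 4 * (ψ (Q k) / Q k) := mul_pos (by linarith [hη0 k]) (hr k)
  rw [ENNReal.ofReal_le_ofReal_iff (by positivity)] at h1
  have h2 : (η k / 4 * (ψ (Q k) / Q k)) ^ s < δ i ^ s := by
    refine Real.rpow_lt_rpow hρ.le (lt_of_le_of_lt ?_ hk) hs
    have h3 : ψ (Q k) / Q k ≤ 1 := by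
      rw [div_le_one (hQ0 k)]
      have h4 := (hstage k).small
      have h5 : (1 : ℝ) ≤ Q k := by exact_mod_cast hQ1 k
      nlinarith [hψQ k]
    have h4 : η k / 4 * (ψ (Q k) / Q k) ≤ η k / 4 * 1 :=
      mul_le_mul_of_nonneg_left h3 (by linarith [hη0 k])
    have h5 := hη0 k
    change _ ≤ η k
    linarith
  linarith [Real.rpow_pos_of_pos (hδ i) s]

/-! ### The dimension formula -/

theorem theorem1 (ψ : ℕ → ℝ)
    (hψ : ∀ q : ℕ, 1 ≤ q → ψ q ∈ Set.Ico (0 : ℝ) (1 / 2))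
    (hmono : AntitoneOn (fun q : ℕ => (q : ℝ) * ψ q) (Set.Ici 1))
    (hzero : Filter.Tendsto (fun q : ℕ => (q : ℝ) * ψ q) Filter.atTop (nhds 0))
    (lam : ℝ≥0∞)
    (hlam : Filter.Tendsto (decayRate ψ) Filter.atTop (nhds (lam : EReal))) :
    dimH (exactApprox 2 ψ) = 3 / (lam + 1) := by
  have hmono' : ∀ m n : ℕ, 1 ≤ m → m ≤ n → n * ψ n ≤ m * ψ m := fun m n hm hmn =>
    hmono (mem_Ici.2 hm) (mem_Ici.2 (hm.trans hmn)) hmn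
  have hupper : ∀ t : ℝ, 0 ≤ t → (t : EReal) < lam →
      dimH (exactApprox 2 ψ) ≤ ENNReal.ofReal (3 / (t + 1)) := fun t ht htl => by
    rw [dimH_exactApprox_eq]
    exact (dimH_mono sdiff_subset).trans (dimH_wellApproxPi_le ht
      (eventually_le_rpow_of_lt_decayRate (hlam.eventually_const_lt htl)))
  induction lam using ENNReal.recTopCoe with
  | top =>
    have h1 : Tendsto (fun t : ℝ => ENNReal.ofReal (3 / (t + 1))) atTop (nhds 0) := by
      have h2 : Tendsto (fun t : ℝ => 3 / (t + 1)) atTop (nhds 0) :=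
        tendsto_const_nhds.div_atTop (tendsto_atTop_add_const_right _ _ tendsto_id)
      simpa using ENNReal.tendsto_ofReal h2
    have h3 : dimH (exactApprox 2 ψ) ≤ 0 := ge_of_tendsto h1 (by
      filter_upwards [eventually_ge_atTop 0] with t ht
      exact hupper t ht (EReal.coe_lt_top t))
    simpa using h3
  | coe l =>
    have hcoe : ((l : ℝ≥0∞) : EReal) = ((l : ℝ) : EReal) := rfl
    have hlow : ∀ τ : ℝ, l < τ → ∀ᶠ q : ℕ in atTop, (q : ℝ) ^ (-τ) ≤ ψ q := fun τ hτ =>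
      eventually_rpow_le_of_decayRate_lt
        (hlam.eventually_lt_const (hcoe ▸ EReal.coe_lt_coe_iff.2 hτ))
    -- A rate below 1 would contradict `qψ(q) → 0`. The bound `1 ≤ l` later yields `s ≤ 2`.
    have hl1 : (1 : ℝ) ≤ l := by
      by_contra! hc
      have h1 : ∀ᶠ q : ℕ in atTop, (1 : ℝ) ≤ q * ψ q := by
        filter_upwards [hlow 1 hc, eventually_ge_atTop 1] with q hq hq1
        have hq0 : (0 : ℝ) < q := by exact_mod_cast hq1
        rw [Real.rpow_neg_one, inv_le_iff_one_le_mul₀ hq0] at hq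
        linarith
      exact absurd (ge_of_tendsto hzero h1) (by norm_num)
    -- A finite rate makes `ψ` positive eventually, and monotonicity of `qψ(q)` carries this back to
    -- every `n`.
    have hpos : ∀ n, 1 ≤ n → 0 < ψ n := fun n hn => by
      obtain ⟨m, hm, hmn⟩ := ((hlow (l + 1) (by linarith)).and (eventually_ge_atTop n)).exists
      have hm0 : (0 : ℝ) < m := by exact_mod_cast (by omega : 0 < m)
      have hn0 : (0 : ℝ) < n := by exact_mod_cast hn
      have h1 : 0 < ψ m := lt_of_lt_of_le (by positivity) hm
      exact pos_of_mul_pos_right ((mul_pos hm0 h1).trans_le (hmono' n m hn hmn)) hn0.le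
    have hrhs : (3 : ℝ≥0∞) / ((l : ℝ≥0∞) + 1) = ENNReal.ofReal (3 / ((l : ℝ) + 1)) := by
      rw [ENNReal.ofReal_div_of_pos (by positivity), ENNReal.ofReal_add l.coe_nonneg zero_le_one]
      simp
    rw [hrhs]
    apply le_antisymm
    · have h1 : Tendsto (fun t : ℝ => ENNReal.ofReal (3 / (t + 1))) (𝓝[<] (l : ℝ))
          (nhds (ENNReal.ofReal (3 / ((l : ℝ) + 1)))) := by
        apply ENNReal.tendsto_ofReal
        have h2 : ContinuousAt (fun t : ℝ => 3 / (t + 1)) l :=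
          continuousAt_const.div (by fun_prop) (by positivity)
        exact h2.tendsto.mono_left nhdsWithin_le_nhds
      refine ge_of_tendsto h1 ?_
      filter_upwards [Ioo_mem_nhdsLT (show (0 : ℝ) < l by linarith)] with t ht
      exact hupper t ht.1.le (hcoe ▸ EReal.coe_lt_coe_iff.2 ht.2)
    · rw [dimH_exactApprox_eq]
      refine le_of_forall_lt fun d hd => ?_
      obtain ⟨s, hds, hs⟩ := ENNReal.lt_iff_exists_nnreal_btwn.1 hd
      refine hds.trans_le ?_
      have hs0 : 0 < (s : ℝ) := by
        have : (0 : ℝ≥0∞) < s := zero_le.trans_lt hds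
        exact_mod_cast this
      have hs3 : (s : ℝ) < 3 / ((l : ℝ) + 1) := by
        rw [ENNReal.lt_ofReal_iff_toReal_lt ENNReal.coe_ne_top] at hs
        simpa using hs
      rw [lt_div_iff₀ (by positivity)] at hs3
      obtain ⟨τ, hτl, hτ⟩ : ∃ τ : ℝ, l < τ ∧ (τ + 1) * s < 3 := by
        -- Chosen so that `(τ+1)s` is the midpoint of `(l+1)s` and 3.
        refine ⟨l + (3 - s * (l + 1)) / (2 * s), ?_, ?_⟩
        · have : 0 < (3 - s * (l + 1)) / (2 * (s : ℝ)) := div_pos (by linarith) (by linarith)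
          linarith
        · have e : ((l : ℝ) + (3 - s * (l + 1)) / (2 * s) + 1) * s =
              (s * (l + 1) + 3) / 2 := by
            field_simp; ring
          rw [e]; linarith
      exact le_dimH_of_hausdorffMeasure_ne_zero
        (hausdorffMeasure_exactApproxPi_ne_zero hpos hmono' hzero (by linarith) (hlow τ hτl) hs0
          (by nlinarith) hτ)
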